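/- Let $a:\mathbb R\to\mathbb R$ be measurable with $\delta\le a\le C$ a.e. for some constants $\delta,C>0$. Let $\varepsilon>0$ and let $b_\varepsilon$ be a measurable function on $(-\varepsilon,\varepsilon)$ with $\delta_\varepsilon\le b_\varepsilon\le C_\varepsilon$ a.e. for some constants $\delta_\varepsilon,C_\varepsilon>0$. Put $a_\varepsilon(x)=a(x-\varepsilon)$ for $x\ge\varepsilon$, $a_\varepsilon(x)=b_\varepsilon(x)$ for $|x|<\varepsilon$, and $a_\varepsilon(x)=a(x+\varepsilon)$ for $x\le-\varepsilon$. Let $\lambda_\varepsilon(dx)=a_\varepsilon(x)^{-1}dx$ and $\mathtt s_\varepsilon(x)=\int_0^x a_\varepsilon(y)^{-1}dy$. Write $f\ll\lambda_\varepsilon$ if $f=g\circ\mathtt s_\varepsilon$ with $g$ absolutely continuous on compact intervals, and then $\frac{df}{d\lambda_\varepsilon}:=g'\circ\mathtt s_\varepsilon$. Consider on $L^2(\mathbb R)$ the form $$\mathscr F^\varepsilon=\Big\{f\in L^2(\mathbb R): f\ll\lambda_\varepsilon,\ \int_{\mathbb R}\Big(\frac{df}{d\lambda_\varepsilon}\Big)^2d\lambda_\varepsilon<\infty,\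 f(\pm\infty)=0\text{ if }\lambda_\varepsilon(\mathbb R_\pm)<\infty\Big\},\qquad \mathscr E^\varepsilon(f,g)=\frac12\int_{\mathbb R}\frac{df}{d\lambda_\varepsilon}\frac{dg}{d\lambda_\varepsilon}\,d\lambda_\varepsilon .$$ There is exactly one strongly continuous symmetric contraction semigroup $(P^\varepsilon_t)_{t\ge0}$ on $L^2(\mathbb R)$ associated with $(\mathscr E^\varepsilon,\mathscr F^\varepsilon)$, that is, whose generator $L$ satisfies: $u\in D(L)$ and $Lu=f$ if and only if $u\in\mathscr F^\varepsilon$ and $\mathscr E^\varepsilon(u,v)=-(f,v)_{L^2}$ for all $v\in\mathscr F^\varepsilon$. Let $u_0\in H^1(\mathbb R)$, i.e. $u_0\in L^2(\mathbb R)$ is absolutely continuous on compact intervals with $u_0'\in L^2(\mathbb R)$. A weak solution of $$\partial_t u=\tfrac12\nabla(a_\varepsilon\nabla u),\qquad u(0,\cdot)=u_0,$$ is a function $u\in C_b([0,\infty),L^2(\mathbb R))\cap L^\infty([0,\infty),H^1(\mathbb R))$ with $u(0,\cdot)=u_0$ such that for all $t>0$ and $g\in C_c^\infty(\mathbb R)$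 $$\int_{\mathbb R}(u_0(x)-u(t,x))g(x)\,dx=\frac12\int_0^t\int_{\mathbb R}a_\varepsilon(x)\nabla u(s,x)\nabla g(x)\,dx\,ds .$$ Then $u^\varepsilon_t:=P^\varepsilon_tu_0$ is a weak solution, and it is the only one. Moreover, if $(X_t)$, with laws $(\mathbf P_x)_{x\in\mathbb R}$, is a conservative Markov process on $\mathbb R$ with continuous paths and $L^2$-semigroup $(P^\varepsilon_t)$ (that is, $x\mapsto\mathbf E_xf(X_t)$ is a version of $P^\varepsilon_tf$ for all $t\ge0$ and all bounded Borel $f\in L^2(\mathbb R)$), then for every $t\ge0$, $u^\varepsilon_t(x)=\mathbf E_xu_0(X_t)$ for a.e. $x\in\mathbb R$. -/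

import Mathlib

open MeasureTheory Filter Topology
open scoped NNReal ENNReal

noncomputable section

namespace StiffHeat

/-- The Hilbert space `L²(ℝ)` of classes of square-integrable functions (Lebesgue measure). -/
abbrev L2 : Type := Lp ℝ 2 (volume : Measure ℝ)

/-! ### The Sobolev space `H¹(ℝ)` -/

/-- `f ∈ H¹(ℝ)`: `f` is in `L²`, absolutely continuous (on every compact interval), and
its (a.e. defined) derivative is in `L²`. -/
structure MemH1 (f : ℝ → ℝ) : Prop where
  memLp : MemLp f 2 volume
  absCont : ∀ x y : ℝ, AbsolutelyContinuousOnInterval f x y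
  memLp_deriv : MemLp (deriv f) 2 volume

/-- The class `u` belongs to `H¹(ℝ)` and `w` is the class of its gradient. -/
def IsGradient (u w : L2) : Prop :=
  ∃ f : ℝ → ℝ, MemH1 f ∧ u =ᵐ[volume] f ∧ w =ᵐ[volume] deriv f

/-! ### The conductivity and the thermal resistance -/

/-- The conductivity `a_ε`: the barrier `(-ε, ε)` with conductivity `b` is inserted at `0` into
a material with conductivity `a`. -/
def conductivity (a b : ℝ → ℝ) (ε x : ℝ) : ℝ :=
  if ε ≤ x then a (x - ε) else if x ≤ -ε then a (x + ε) else b x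

/-- The thermal resistance `λ(dx) = dx / c(x)` of a material with conductivity `c`. -/
def resistance (c : ℝ → ℝ) : Measure ℝ :=
  volume.withDensity fun x => ENNReal.ofReal (c x)⁻¹

/-- The scale function `s(x) = ∫₀ˣ dy / c(y)` induced by the thermal resistance. -/
def scale (c : ℝ → ℝ) (x : ℝ) : ℝ := ∫ y in (0 : ℝ)..x, (c y)⁻¹

/-! ### The Dirichlet form of the diffusion with scale function `s` and Lebesgue speed measure -/

/-- The class `u` has a version `f` with `f ≪ λ` and `df/dλ = h`, that is, `f = g ∘ s` with `g`
absolutely continuous (on compact subintervals of the range of `s`) and `h = g' ∘ s`; moreover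
`f` vanishes at an end of `ℝ` near which the thermal resistance is finite. -/
def HasScaleDeriv (c : ℝ → ℝ) (u : L2) (h : ℝ → ℝ) : Prop :=
  ∃ g : ℝ → ℝ,
    (∀ x y : ℝ, AbsolutelyContinuousOnInterval g (scale c x) (scale c y)) ∧
    u =ᵐ[volume] g ∘ scale c ∧
    h = deriv g ∘ scale c ∧
    (resistance c (Set.Ici 0) < ∞ → Tendsto (g ∘ scale c) atTop (𝓝 0)) ∧
    (resistance c (Set.Iic 0) < ∞ → Tendsto (g ∘ scale c) atBot (𝓝 0))

open Classical in
/-- `du/dλ` for the version of `u` that is absolutely continuous with respect to `λ`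
(the zero function if there is none). -/
def scaleDeriv (c : ℝ → ℝ) (u : L2) : ℝ → ℝ :=
  if h : ∃ w, HasScaleDeriv c u w then h.choose else 0

/-- The domain `𝓕 = {u ∈ L² : u ≪ λ, ∫ (du/dλ)² dλ < ∞, u(±∞) = 0 if λ(ℝ±) < ∞}`. -/
def formDomain (c : ℝ → ℝ) : Set L2 :=
  {u | ∃ h, HasScaleDeriv c u h ∧ MemLp h 2 (resistance c)}

/-- The form `𝓔(u, v) = ½ ∫ (du/dλ) (dv/dλ) dλ`. -/
def energy (c : ℝ → ℝ) (u v : L2) : ℝ :=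
  1 / 2 * ∫ x, scaleDeriv c u x * scaleDeriv c v x ∂(resistance c)

/-! ### The semigroup of a form, and of a process -/

/-- `(P_t)` is the strongly continuous symmetric contraction semigroup on `L²(ℝ)` associated
with the form `(E, F)`: its generator `L` is given by `u ∈ D(L)`, `L u = f` if and only if
`u ∈ F` and `E(u, v) = (-f, v)` for all `v ∈ F`. -/
structure IsSemigroupOf (F : Set L2) (E : L2 → L2 → ℝ) (P : ℝ≥0 → L2 →L[ℝ] L2) : Prop where
  zero : P 0 = ContinuousLinearMap.id ℝ L2
  add : ∀ s t, P (s + t) = (P s).comp (P t)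
  contraction : ∀ t, ‖P t‖ ≤ 1
  symm : ∀ t f g, inner ℝ (P t f) g = inner ℝ f (P t g)
  continuous : ∀ f, Continuous fun t => P t f
  generator : ∀ u f : L2,
    Tendsto (fun t : ℝ≥0 => (t : ℝ)⁻¹ • (P t u - u)) (𝓝[>] 0) (𝓝 f) ↔
      u ∈ F ∧ ∀ v ∈ F, E u v = -inner ℝ f v

/-- A (conservative, time homogeneous) Markov process on `ℝ` with continuous paths: `law x` is
the law under which the process starts from `x`. -/
structure ContMarkovProcess (Ω : Type*) [MeasurableSpace Ω] where
  law : ProbabilityTheory.Kernel ℝ Ω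
  X : ℝ≥0 → Ω → ℝ
  isMarkov_law : ProbabilityTheory.IsMarkovKernel law
  measurable : ∀ t, Measurable (X t)
  continuous_path : ∀ ω, Continuous fun t => X t ω
  start : ∀ x, ∀ᵐ ω ∂(law x), X 0 ω = x
  /-- The Markov property with respect to the natural filtration. -/
  markov : ∀ (x : ℝ) (s t : ℝ≥0) (A : Set Ω) (B : Set ℝ),
    MeasurableSet[⨆ r : Set.Iic s, MeasurableSpace.comap (X r) inferInstance] A →
    MeasurableSet B →
    law x (A ∩ X (s + t) ⁻¹' B) = ∫⁻ ω in A, law (X s ω) (X t ⁻¹' B) ∂(law x)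

/-- The process has `L²`-semigroup `(P_t)`: for bounded Borel functions `f ∈ L²(ℝ)`,
`x ↦ 𝐄_x f(X_t)` is a version of `P_t f`. -/
def ContMarkovProcess.HasSemigroup {Ω : Type*} [MeasurableSpace Ω] (Y : ContMarkovProcess Ω)
    (P : ℝ≥0 → L2 →L[ℝ] L2) : Prop :=
  ∀ (t : ℝ≥0) (f : ℝ → ℝ) (hf : MemLp f 2 volume), Measurable f → (∃ K, ∀ x, |f x| ≤ K) →
    P t (hf.toLp f) =ᵐ[volume] fun x => ∫ ω, f (Y.X t ω) ∂(Y.law x)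

/-! ### Weak solutions -/

/-- `u ∈ L^∞([0,∞), H¹(ℝ))` with gradient `w` (only the values `w t`, `t ≥ 0`,
matter; `H¹(ℝ)` being identified with its image in
`L² × L²` under `u ↦ (u, ∇u)`). -/
structure MemLinftyH1 (u : ℝ≥0 → L2) (w : ℝ → L2) : Prop where
  memLp : MemLp (fun t : ℝ => u t.toNNReal) ∞ (volume.restrict (Set.Ici 0))
  memLp_grad : MemLp w ∞ (volume.restrict (Set.Ici 0))
  isGradient : ∀ᵐ t ∂(volume.restrict (Set.Ici (0 : ℝ))), IsGradient (u t.toNNReal) (w t)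

/-- `u` is a weak solution, in `C_b([0,∞), L²(ℝ)) ∩ L^∞([0,∞), H¹(ℝ))`, of
`∂_t u = ½ ∇(c ∇u)`, `u(0) = u₀`. -/
structure IsWeakSolution (c u₀ : ℝ → ℝ) (u : ℝ≥0 → L2) : Prop where
  continuous : Continuous u
  bounded : ∃ K, ∀ t, ‖u t‖ ≤ K
  initial : u 0 =ᵐ[volume] u₀
  weak : ∃ w : ℝ → L2, MemLinftyH1 u w ∧
    ∀ t : ℝ≥0, 0 < t → ∀ g : ℝ → ℝ, ContDiff ℝ (⊤ : ℕ∞) g → HasCompactSupport g →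
      ∫ x, (u₀ x - u t x) * g x =
        1 / 2 * ∫ s in (0 : ℝ)..t, ∫ x, c x * w s x * deriv g x

end StiffHeat

end

/-! The conductivity `c` lies a.e. between two positive constants, so the scale function is
bi-Lipschitz and onto. Hence `f ≪ λ` means that `f` is absolutely continuous, with `df/dλ = c f'`
a.e.; both half-lines have infinite resistance, so the conditions at infinity are void. The form
domain is therefore `H¹`, and the form is `½ ∫ c u' v'` (`IsElliptic.mem_formDomain_iff`,
`IsElliptic.energy_eq`).

Let `A u = √(c/2) u'`. The gradient is closed and densely defined, and multiplication by `√(c/2)` is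
invertible on `L²`, so `A` is closed and densely defined, the form is `⟪A u, A v⟫`, and its operator
is `G = -A*A`, nonpositive and self-adjoint (`isNonposSelfAdjoint_formGenerator`). Yosida
approximation turns `G` into a semigroup (`exists_semigroup`).

Both uniqueness claims rest on `eq_zero_of_forall_inner`: if `z` is continuous and solves `z' = G
z`, `z(0) = 0` weakly against the domain of `G`, then its primitive `Z` satisfies `Z' = G Z`, so
`‖Z‖` decreases from `0`.

That `P_t u₀` is a weak solution is clear for `u₀` in the domain of `G`. This domain is a core of
the form and the energy decreases along the semigroup, so approximation reaches every `u₀ ∈ H¹`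
(`exists_form_evolution`). Conversely, a weak solution is tested only against smooth compactly
supported functions; the du Bois-Reymond lemma extends this to `H¹`, in particular to the domain of
`G`, and uniqueness applies. The probabilistic formula is immediate, because functions in `H¹` are
bounded and continuous. -/

namespace StiffHeat

open scoped InnerProductSpace

/-! ### Nonpositive self-adjoint operators and their resolvents. -/

section Abstract

variable {H : Type*} [NormedAddCommGroup H] [InnerProductSpace ℝ H]

/-- The graph `G` of a densely defined nonpositive self-adjoint operator: `G u f` means that `u`
is in the domain and is mapped to `f`. -/
structure IsNonposSelfAdjoint (G : H → H → Prop) : Prop where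
  add : ∀ {u f v g}, G u f → G v g → G (u + v) (f + g)
  smul : ∀ (r : ℝ) {u f}, G u f → G (r • u) (r • f)
  nonpos : ∀ {u f}, G u f → ⟪f, u⟫_ℝ ≤ 0
  symm : ∀ {u f v g}, G u f → G v g → ⟪f, v⟫_ℝ = ⟪u, g⟫_ℝ
  surj : ∀ h : ℝ, 0 < h → ∀ f, ∃ u g, G u g ∧ u - h • g = f
  dense : Dense {u | ∃ f, G u f}

/-- `P` is a strongly continuous symmetric contraction semigroup whose generator has graph `G`. -/
structure IsSymmSemigroup (G : H → H → Prop) (P : ℝ≥0 → H →L[ℝ] H) : Prop where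
  zero : P 0 = ContinuousLinearMap.id ℝ H
  add : ∀ s t, P (s + t) = (P s).comp (P t)
  contraction : ∀ t, ‖P t‖ ≤ 1
  symm : ∀ t f g, ⟪P t f, g⟫_ℝ = ⟪f, P t g⟫_ℝ
  continuous : ∀ f, Continuous fun t => P t f
  generator : ∀ u f,
    Tendsto (fun t : ℝ≥0 => (t : ℝ)⁻¹ • (P t u - u)) (𝓝[>] 0) (𝓝 f) ↔ G u f

namespace IsNonposSelfAdjoint

variable {G : H → H → Prop}

lemma sub (hG : IsNonposSelfAdjoint G) {u f v g : H} (h₁ : G u f) (h₂ : G v g) :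
    G (u - v) (f - g) := by
  simpa [sub_eq_add_neg] using hG.add h₁ (hG.smul (-1) h₂)

/-- In the expansion of `‖u - h g‖²` the cross term `-2h⟪u, g⟫` is nonnegative. This makes `1 - hG`
injective and its inverse a contraction. -/
lemma norm_le_norm_sub (hG : IsNonposSelfAdjoint G) {h : ℝ} (hh : 0 < h) {u g : H} (hu : G u g) :
    ‖u‖ ≤ ‖u - h • g‖ := by
  have h1 := norm_sub_sq_real u (h • g)
  have h2 : ⟪u, h • g⟫_ℝ ≤ 0 := by
    rw [inner_smul_right, real_inner_comm]
    exact mul_nonpos_of_nonneg_of_nonpos hh.le (hG.nonpos hu)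
  refine le_of_sq_le_sq ?_ (norm_nonneg _)
  nlinarith [sq_nonneg ‖h • g‖]

lemma eq_of_sub_eq (hG : IsNonposSelfAdjoint G) {h : ℝ} (hh : 0 < h) {u g u' g' : H} (hu : G u g)
    (hu' : G u' g') (he : u - h • g = u' - h • g') : u = u' := by
  have h1 := hG.norm_le_norm_sub hh (hG.sub hu hu')
  have h2 : u - u' - h • (g - g') = 0 := by
    rw [smul_sub, ← sub_eq_zero.2 he]; abel
  rw [h2, norm_zero] at h1
  exact sub_eq_zero.1 (norm_le_zero_iff.1 h1)

/-- The resolvent `J = (1 - hG)⁻¹`. -/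
lemma exists_resolvent (hG : IsNonposSelfAdjoint G) {h : ℝ} (hh : 0 < h) :
    ∃ J : H →L[ℝ] H, ‖J‖ ≤ 1 ∧ (∀ f, G (J f) (h⁻¹ • (J f - f))) ∧
      ∀ u g, G u g → J (u - h • g) = u := by
  choose j k hjk hj using hG.surj h hh
  have key : ∀ u g f, G u g → u - h • g = f → j f = u := fun u g f hu he =>
    hG.eq_of_sub_eq hh (hjk f) hu (by rw [hj, he])
  let L : H →ₗ[ℝ] H :=
    { toFun := j
      map_add' := fun f f' => key _ _ _ (hG.add (hjk f) (hjk f')) (by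
        conv_rhs => rw [← hj f, ← hj f']
        rw [smul_add]; abel)
      map_smul' := fun r f => key _ _ _ (hG.smul r (hjk f)) (by
        conv_rhs => rw [← hj f]
        rw [smul_sub, smul_comm]; rfl) }
  have hk : ∀ f, k f = h⁻¹ • (j f - f) := fun f => by
    rw [eq_inv_smul_iff₀ hh.ne', ← sub_eq_zero]
    have := hj f
    rw [← sub_eq_zero] at this
    rw [← neg_eq_zero, ← this]; abel
  refine ⟨L.mkContinuous 1 fun f => ?_, L.mkContinuous_norm_le zero_le_one _, fun f => ?_,
    fun u g hu => key u g _ hu rfl⟩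
  · have := hG.norm_le_norm_sub hh (hjk f)
    rw [hj] at this
    simpa [L] using this
  · have := hjk f
    rw [hk] at this
    exact this

end IsNonposSelfAdjoint

/-! ### Exponentials of bounded dissipative operators -/

section Exp

variable [CompleteSpace H]

/-- The semigroup `exp (t B)` of a bounded operator. -/
noncomputable def expSemigroup (B : H →L[ℝ] H) (t : ℝ) : H →L[ℝ] H := NormedSpace.exp (t • B)

lemma hasDerivAt_expSemigroup (B : H →L[ℝ] H) (f : H) (t : ℝ) :
    HasDerivAt (fun s => expSemigroup B s f) (expSemigroup B t (B f)) t := by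
  have h := hasDerivAt_exp_smul_const (𝕂 := ℝ) B t
  exact (ContinuousLinearMap.apply ℝ H f).hasFDerivAt.comp_hasDerivAt t h

lemma hasDerivAt_expSemigroup' (B : H →L[ℝ] H) (f : H) (t : ℝ) :
    HasDerivAt (fun s => expSemigroup B s f) (B (expSemigroup B t f)) t := by
  have h := hasDerivAt_exp_smul_const' (𝕂 := ℝ) B t
  exact (ContinuousLinearMap.apply ℝ H f).hasFDerivAt.comp_hasDerivAt t h

omit [CompleteSpace H] in
lemma expSemigroup_zero (B : H →L[ℝ] H) : expSemigroup B 0 = ContinuousLinearMap.id ℝ H := by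
  simp [expSemigroup]; rfl

lemma expSemigroup_add (B : H →L[ℝ] H) (s t : ℝ) :
    expSemigroup B (s + t) = (expSemigroup B s).comp (expSemigroup B t) := by
  let : NormedAlgebra ℚ (H →L[ℝ] H) := NormedAlgebra.restrictScalars ℚ ℝ _
  rw [expSemigroup, add_smul, NormedSpace.exp_add_of_commute]
  · rfl
  · exact ((Commute.refl B).smul_left s).smul_right t

lemma expSemigroup_symm {B : H →L[ℝ] H} (hB : IsSelfAdjoint B) (t : ℝ) (f g : H) :
    ⟪expSemigroup B t f, g⟫_ℝ = ⟪f, expSemigroup B t g⟫_ℝ := by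
  have h1 : IsSelfAdjoint (t • B) := by
    rw [IsSelfAdjoint, star_smul, hB.star_eq]; simp
  have h : IsSelfAdjoint (expSemigroup B t) := h1.exp
  rw [← ContinuousLinearMap.adjoint_inner_left, h.adjoint_eq]

lemma norm_expSemigroup_apply_le {B : H →L[ℝ] H} (hB : ∀ x, ⟪B x, x⟫_ℝ ≤ 0) {t : ℝ} (ht : 0 ≤ t)
    (f : H) : ‖expSemigroup B t f‖ ≤ ‖f‖ := by
  have hd : ∀ s, HasDerivAt (fun s => ‖expSemigroup B s f‖ ^ 2)
      (2 * ⟪expSemigroup B s f, B (expSemigroup B s f)⟫_ℝ) s := fun s =>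
    (hasDerivAt_expSemigroup' B f s).norm_sq
  have ha : Antitone (fun s => ‖expSemigroup B s f‖ ^ 2) := by
    refine antitone_of_deriv_nonpos (fun s => (hd s).differentiableAt) fun s => ?_
    rw [(hd s).deriv, real_inner_comm]
    linarith [hB (expSemigroup B s f)]
  have := ha ht
  simp only [expSemigroup_zero, ContinuousLinearMap.id_apply] at this
  exact le_of_sq_le_sq this (norm_nonneg _)

omit [CompleteSpace H] in
lemma commute_expSemigroup {B C : H →L[ℝ] H} (h : Commute B C) (t : ℝ) (f : H) :
    C (expSemigroup B t f) = expSemigroup B t (C f) := by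
  have : Commute (expSemigroup B t) C := (h.smul_left t).exp_left
  exact (DFunLike.congr_fun this.eq f).symm

/-- The bound involves `B` and `C` only through `B f - C f`, not through their operator norms, so it
remains useful for Yosida approximations whose norms may blow up. -/
lemma norm_expSemigroup_sub_le {B C : H →L[ℝ] H} (hB : ∀ x, ⟪B x, x⟫_ℝ ≤ 0)
    (hC : ∀ x, ⟪C x, x⟫_ℝ ≤ 0) (h : Commute B C) {t : ℝ} (ht : 0 ≤ t) (f : H) :
    ‖expSemigroup B t f - expSemigroup C t f‖ ≤ t * ‖B f - C f‖ := by
  -- the derivative of `exp (s B) exp ((t - s) C) f`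
  have hd : ∀ s, HasDerivAt (fun s => expSemigroup B s (expSemigroup C (t - s) f))
      (expSemigroup B s (expSemigroup C (t - s) (B f - C f))) s := fun s => by
    have h1 := hasDerivAt_exp_smul_const (𝕂 := ℝ) B s
    have h2 : HasDerivAt (fun s => expSemigroup C (t - s) f)
        (-(expSemigroup C (t - s) (C f))) s := by
      have := (hasDerivAt_expSemigroup C f (t - s)).scomp s ((hasDerivAt_id s).const_sub t)
      rw [neg_one_smul] at this
      exact this
    refine (h1.clm_apply h2).congr_deriv ?_
    change expSemigroup B s (B _) + expSemigroup B s _ = _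
    rw [commute_expSemigroup h.symm, ← map_add, ← sub_eq_add_neg, ← map_sub]
  have := norm_image_sub_le_of_norm_deriv_le_segment' (a := 0) (b := t) (C := ‖B f - C f‖)
    (fun s _ => (hd s).hasDerivWithinAt) (fun s hs => ?_) t ⟨ht, le_rfl⟩
  · simpa [expSemigroup_zero, mul_comm] using this
  · exact (norm_expSemigroup_apply_le hB hs.1 _).trans
      (norm_expSemigroup_apply_le hC (sub_nonneg.2 hs.2.le) _)

lemma norm_expSemigroup_sub_self_le {B : H →L[ℝ] H} (hB : ∀ x, ⟪B x, x⟫_ℝ ≤ 0) {t : ℝ} (ht : 0 ≤ t)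
    (f : H) : ‖expSemigroup B t f - f‖ ≤ t * ‖B f‖ := by
  have h := norm_expSemigroup_sub_le (C := 0) hB (by simp) (Commute.zero_right B) ht f
  simpa [expSemigroup] using h

/-- Controls the difference quotient when `B` runs through the Yosida approximations and `g` is the
limit of `B f`. Since `g` need not be in the domain of the limit operator, `B g` may be unbounded
along the way; `g'` is a nearby element of the domain replacing it. -/
lemma norm_expSemigroup_sub_sub_le {B : H →L[ℝ] H} (hB : ∀ x, ⟪B x, x⟫_ℝ ≤ 0) {t : ℝ} (ht : 0 ≤ t)
    (f g g' : H) : ‖expSemigroup B t f - f - t • g‖ ≤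
      t * (‖B f - g‖ + 2 * ‖g - g'‖ + t * ‖B g'‖) := by
  have hd : ∀ s, HasDerivAt (fun s => expSemigroup B s f - f - s • g)
      (expSemigroup B s (B f) - g) s := fun s => by
    simpa using ((hasDerivAt_expSemigroup B f s).sub_const f).fun_sub
      ((hasDerivAt_id s).smul_const g)
  have := norm_image_sub_le_of_norm_deriv_le_segment' (a := 0) (b := t)
    (C := ‖B f - g‖ + 2 * ‖g - g'‖ + t * ‖B g'‖)
    (fun s _ => (hd s).hasDerivWithinAt) (fun s hs => ?_) t ⟨ht, le_rfl⟩
  · simpa [expSemigroup_zero, mul_comm] using this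
  · have e : expSemigroup B s (B f) - g = expSemigroup B s (B f - g) +
        expSemigroup B s (g - g') + (g' - g) + (expSemigroup B s g' - g') := by
      simp only [map_sub]; abel
    rw [e]
    refine (norm_add_le _ _).trans (add_le_add ?_ ?_)
    · have h1 := norm_expSemigroup_apply_le hB hs.1 (B f - g)
      have h2 := norm_expSemigroup_apply_le hB hs.1 (g - g')
      have h3 := norm_sub_rev g g'
      have h4 := norm_add₃_le (a := expSemigroup B s (B f - g)) (b := expSemigroup B s (g - g'))
        (c := g' - g)
      linarith
    · exact (norm_expSemigroup_sub_self_le hB hs.1 g').trans (by gcongr; exact hs.2.le)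

end Exp

end Abstract

/-! ### Generation of the semigroup by Yosida approximation. -/

section Generation

variable {H : Type*} [NormedAddCommGroup H] [InnerProductSpace ℝ H]

lemma tendsto_of_dense_of_norm_le {ι : Type*} {l : Filter ι} {D : Set H} (hD : Dense D)
    {T : ι → H →L[ℝ] H} {S : H →L[ℝ] H} (hT : ∀ i, ‖T i‖ ≤ 1) (hS : ‖S‖ ≤ 1)
    (h : ∀ f ∈ D, Tendsto (fun i => T i f) l (𝓝 (S f))) (f : H) :
    Tendsto (fun i => T i f) l (𝓝 (S f)) := by
  rw [Metric.tendsto_nhds]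
  intro ε hε
  obtain ⟨g, hg, hgf⟩ := Metric.dense_iff.1 hD f (ε / 3) (by positivity)
  rw [Metric.mem_ball, dist_eq_norm] at hg
  filter_upwards [Metric.tendsto_nhds.1 (h g hgf) (ε / 3) (by positivity)] with i hi
  rw [dist_eq_norm] at hi ⊢
  have e : T i f - S f = (T i g - S g) + S (g - f) - T i (g - f) := by
    simp only [map_sub]; abel
  have h1 := (T i).le_of_opNorm_le (hT i) (g - f)
  have h2 := S.le_of_opNorm_le hS (g - f)
  rw [e]
  calc _ ≤ ‖T i g - S g‖ + ‖S (g - f)‖ + ‖T i (g - f)‖ :=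
        (norm_sub_le _ _).trans (by gcongr; exact norm_add_le _ _)
    _ < ε := by linarith

variable {G : H → H → Prop}

namespace IsNonposSelfAdjoint

lemma eq_of_eq (hG : IsNonposSelfAdjoint G) {u f g : H} (hf : G u f) (hg : G u g) : f = g := by
  have h := hG.sub hf hg
  rw [sub_self] at h
  refine sub_eq_zero.1 (hG.dense.eq_zero_of_inner_left (𝕜 := ℝ) fun v hv => ?_)
  obtain ⟨k, hv⟩ := hv
  rw [hG.symm h hv, inner_zero_left]

/-- If `⟪f, v⟫_ℝ = ⟪u, Gv⟫_ℝ` for all `v` in the domain then `u` is in the domain and `Gu = f`. -/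
lemma of_forall_inner_eq (hG : IsNonposSelfAdjoint G) {u f : H}
    (h : ∀ v g, G v g → ⟪f, v⟫_ℝ = ⟪u, g⟫_ℝ) : G u f := by
  -- Solve `(1 - G) u' = u - f`. By symmetry `u - u'` is orthogonal to the range of `1 - G`, which
  -- is everything.
  obtain ⟨u', f', hu', he⟩ := hG.surj 1 one_pos (u - f)
  have key : u - u' = 0 := by
    refine ext_inner_right ℝ fun w => ?_
    obtain ⟨v, g, hv, rfl⟩ := hG.surj 1 one_pos w
    have h1 := h v g hv
    have h2 := hG.symm hu' hv
    have h3 : ⟪u' - f', v⟫_ℝ = ⟪u - f, v⟫_ℝ := by rw [← he, one_smul]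
    simp only [inner_sub_left, inner_sub_right, one_smul, inner_zero_left] at h3 ⊢
    linarith
  have e : u = u' := sub_eq_zero.1 key
  subst e
  rw [one_smul, sub_right_inj] at he
  exact he ▸ hu'

variable [CompleteSpace H]

/-- The Yosida approximations. -/
lemma exists_yosida (hG : IsNonposSelfAdjoint G) :
    ∃ B : ℕ → H →L[ℝ] H, (∀ n x, ⟪B n x, x⟫_ℝ ≤ 0) ∧ (∀ n, IsSelfAdjoint (B n)) ∧
      (∀ n m, Commute (B n) (B m)) ∧ ∀ u f, G u f → Tendsto (fun n => B n u) atTop (𝓝 f) := by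
  -- With `J n = (1 - (n+1)⁻¹ G)⁻¹`, the approximation is `B n = (n+1)(J n - 1)`. On the domain it
  -- equals `J n` applied to `G u`, which tends to `G u` because `J n → 1` strongly.
  have hpos : ∀ n : ℕ, (0 : ℝ) < ((n : ℝ) + 1)⁻¹ := fun n => by positivity
  choose J hJ1 hJ2 hJ3 using fun n => hG.exists_resolvent (hpos n)
  simp only [inv_inv] at hJ2
  have hsymm : ∀ n f g, ⟪J n f, g⟫_ℝ = ⟪f, J n g⟫_ℝ := fun n f g => by
    have h1 := hG.symm (hJ2 n f) (hJ2 n g)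
    simp only [inner_smul_left, inner_smul_right, inner_sub_left, inner_sub_right,
      RCLike.conj_to_real] at h1
    have h2 : (0 : ℝ) < (n : ℝ) + 1 := by positivity
    nlinarith
  have hcomm : ∀ n m f, J n (J m f) = J m (J n f) := fun n m f => by
    have key : ∀ (n m : ℕ) f, ((n : ℝ) + 1) • (J n (J m f) - J m f) =
        ((m : ℝ) + 1) • (J n (J m f) - J n f) := fun n m f => by
      have h1 := hJ3 n _ _ (hJ2 m f)
      rw [map_sub, map_smul, map_smul, map_sub, sub_eq_iff_eq_add, ← sub_eq_iff_eq_add'] at h1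
      rw [h1, smul_smul, mul_inv_cancel₀ (by positivity), one_smul]
    rcases eq_or_ne n m with rfl | hnm
    · rfl
    have h1 := key n m f
    have h2 := key m n f
    -- In the combination of the two resolvent identities the terms `J n f` and `J m f` cancel,
    -- leaving the commutator times `n - m`.
    have h3 : ((n : ℝ) - m) • (J n (J m f) - J m (J n f)) = 0 := by
      have : ((n : ℝ) - m) • (J n (J m f) - J m (J n f)) =
        (((n : ℝ) + 1) • (J n (J m f) - J m f) - ((m : ℝ) + 1) • (J n (J m f) - J n f)) +
        (((m : ℝ) + 1) • (J m (J n f) - J n f) - ((n : ℝ) + 1) • (J m (J n f) - J m f)) := by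
        module
      rw [this, h1, h2, sub_self, sub_self, add_zero]
    rcases smul_eq_zero.1 h3 with h | h
    · exact absurd (by exact_mod_cast sub_eq_zero.1 h) hnm
    · exact sub_eq_zero.1 h
  have hlim : ∀ f, Tendsto (fun n => J n f) atTop (𝓝 f) := by
    refine tendsto_of_dense_of_norm_le (S := ContinuousLinearMap.id ℝ H) hG.dense hJ1
      ContinuousLinearMap.norm_id_le ?_
    rintro u ⟨g, hu⟩
    rw [tendsto_iff_norm_sub_tendsto_zero]
    refine squeeze_zero (g := fun n : ℕ => ((n : ℝ) + 1)⁻¹ * ‖g‖) (fun _ => norm_nonneg _)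
      (fun n => ?_) ?_
    · have h1 := hJ3 n u g hu
      rw [map_sub, sub_eq_iff_eq_add] at h1
      have h2 := (J n).le_of_opNorm_le (hJ1 n) (((n : ℝ) + 1)⁻¹ • g)
      rw [norm_smul, Real.norm_of_nonneg (hpos n).le, one_mul] at h2
      simpa [h1] using h2
    · have := (tendsto_one_div_add_atTop_nhds_zero_nat (𝕜 := ℝ)).mul_const ‖g‖
      simpa using this
  refine ⟨fun n => ((n : ℝ) + 1) • (J n - ContinuousLinearMap.id ℝ H), fun n x => ?_, fun n => ?_,
    fun n m => ?_, fun u f hu => ?_⟩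
  · have h1 := (J n).le_of_opNorm_le (hJ1 n) x
    have h2 : ⟪J n x, x⟫_ℝ ≤ ⟪x, x⟫_ℝ := by
      rw [real_inner_self_eq_norm_mul_norm]
      exact (real_inner_le_norm _ _).trans (by gcongr; simpa using h1)
    simp only [smul_apply, sub_apply, inner_smul_left,
      inner_sub_left, ContinuousLinearMap.id_apply]
    exact mul_nonpos_of_nonneg_of_nonpos (by simp; positivity) (by linarith)
  · rw [ContinuousLinearMap.isSelfAdjoint_iff_isSymmetric]
    intro x y
    have := hsymm n x y
    simp only [ContinuousLinearMap.coe_coe, smul_apply,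
      sub_apply, inner_smul_left, inner_smul_right, inner_sub_left,
      inner_sub_right, ContinuousLinearMap.id_apply, RCLike.conj_to_real, this]
  · have : Commute (J n) (J m) := ContinuousLinearMap.ext fun f => hcomm n m f
    have h1 : ∀ k : H →L[ℝ] H, Commute k (ContinuousLinearMap.id ℝ H) := Commute.one_right
    have h2 : ∀ k : H →L[ℝ] H, Commute (ContinuousLinearMap.id ℝ H) k := Commute.one_left
    exact (((this.sub_right (h1 _)).sub_left (h2 _)).smul_left _).smul_right _
  · refine (hlim f).congr fun n => ?_
    have h1 := hJ3 n u f hu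
    rw [map_sub, map_smul, sub_eq_iff_eq_add, ← sub_eq_iff_eq_add'] at h1
    simp only [smul_apply, sub_apply,
      ContinuousLinearMap.id_apply]
    rw [h1, smul_smul, mul_inv_cancel₀ (by positivity), one_smul]

/-- The Hille–Yosida theorem for nonpositive self-adjoint operators. -/
theorem exists_semigroup (hG : IsNonposSelfAdjoint G) : ∃ P, IsSymmSemigroup G P := by
  obtain ⟨B, hB1, hB2, hB3, hB4⟩ := hG.exists_yosida
  have hnorm : ∀ n {t : ℝ}, 0 ≤ t → ‖expSemigroup (B n) t‖ ≤ 1 := fun n t ht =>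
    ContinuousLinearMap.opNorm_le_bound _ zero_le_one fun f => by
      simpa using norm_expSemigroup_apply_le (hB1 n) ht f
  -- On the domain the distance is at most `t ‖B m u - B n u‖`, which tends to `0`; contractivity
  -- and density give the rest.
  have hcauchy : ∀ (t : ℝ≥0) f, CauchySeq fun n => expSemigroup (B n) t f := by
    intro t f
    rw [Metric.cauchySeq_iff]
    intro ε hε
    obtain ⟨u, huf, g, hu⟩ := Metric.dense_iff.1 hG.dense f (ε / 4) (by positivity)
    rw [Metric.mem_ball, dist_eq_norm] at huf
    have ht : (0 : ℝ) < t + 1 := by positivity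
    obtain ⟨N, hN⟩ := Metric.cauchySeq_iff.1 (hB4 u g hu).cauchySeq (ε / 4 / (t + 1))
      (by positivity)
    refine ⟨N, fun m hm n hn => ?_⟩
    have h1 := norm_expSemigroup_sub_le (hB1 m) (hB1 n) (hB3 m n) t.2 u
    have h2 := hN m hm n hn
    rw [dist_eq_norm, lt_div_iff₀ ht] at h2
    have h3 := norm_expSemigroup_apply_le (hB1 m) t.2 (u - f)
    have h4 := norm_expSemigroup_apply_le (hB1 n) t.2 (u - f)
    rw [dist_eq_norm]
    have e : expSemigroup (B m) t f - expSemigroup (B n) t f =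
      (expSemigroup (B m) t u - expSemigroup (B n) t u) + expSemigroup (B n) t (u - f) -
        expSemigroup (B m) t (u - f) := by
      simp only [map_sub]; abel
    rw [e]
    have h5 := norm_nonneg (B m u - B n u)
    calc _ ≤ ‖expSemigroup (B m) t u - expSemigroup (B n) t u‖ + ‖expSemigroup (B n) t (u - f)‖ +
          ‖expSemigroup (B m) t (u - f)‖ :=
          (norm_sub_le _ _).trans (by gcongr; exact norm_add_le _ _)
      _ < ε := by
        change ‖expSemigroup (B m) t u - expSemigroup (B n) t u‖ ≤ t * ‖B m u - B n u‖ at h1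
        change ‖expSemigroup (B m) t (u - f)‖ ≤ _ at h3
        change ‖expSemigroup (B n) t (u - f)‖ ≤ _ at h4
        nlinarith
  choose p hp using fun t f => cauchySeq_tendsto_of_complete (hcauchy t f)
  let P : ℝ≥0 → H →L[ℝ] H := fun t =>
    LinearMap.mkContinuous
      { toFun := p t
        map_add' := fun f g => tendsto_nhds_unique (hp t (f + g)) (by
          simpa only [map_add] using (hp t f).add (hp t g))
        map_smul' := fun r f => tendsto_nhds_unique (hp t (r • f)) (by
          simpa only [map_smul, RingHom.id_apply] using (hp t f).const_smul r) } 1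
      fun f => le_of_tendsto (hp t f).norm (Eventually.of_forall fun n => by
        simpa using norm_expSemigroup_apply_le (hB1 n) t.2 f)
  have hP : ∀ (t : ℝ≥0) f, Tendsto (fun n => expSemigroup (B n) t f) atTop (𝓝 (P t f)) := hp
  have hP1 : ∀ t, ‖P t‖ ≤ 1 := fun t => LinearMap.mkContinuous_norm_le _ zero_le_one _
  have hP0 : P 0 = ContinuousLinearMap.id ℝ H := by
    ext f
    refine tendsto_nhds_unique (hP 0 f) ?_
    simp only [NNReal.coe_zero, expSemigroup_zero]
    exact tendsto_const_nhds
  have hPadd : ∀ s t, P (s + t) = (P s).comp (P t) := fun s t => by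
    ext f
    refine tendsto_nhds_unique (hP (s + t) f) ?_
    have h1 : Tendsto (fun n => expSemigroup (B n) s (expSemigroup (B n) t f - P t f)) atTop
        (𝓝 0) := by
      refine squeeze_zero_norm (fun n => norm_expSemigroup_apply_le (hB1 n) s.2 _) ?_
      exact tendsto_iff_norm_sub_tendsto_zero.1 (hP t f)
    have h2 := h1.add (hP s (P t f))
    rw [zero_add] at h2
    refine h2.congr fun n => ?_
    rw [← map_add, sub_add_cancel, NNReal.coe_add, expSemigroup_add]
    rfl
  have hPsub : ∀ (t : ℝ≥0) u f, G u f → ‖P t u - u‖ ≤ t * ‖f‖ := fun t u f hu =>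
    le_of_tendsto_of_tendsto ((hP t u).sub_const u).norm ((hB4 u f hu).norm.const_mul (t : ℝ))
      (Eventually.of_forall fun n => norm_expSemigroup_sub_self_le (hB1 n) t.2 u)
  have hPzero : ∀ f, Tendsto (fun t => P t f) (𝓝 0) (𝓝 f) := by
    refine tendsto_of_dense_of_norm_le (S := ContinuousLinearMap.id ℝ H) hG.dense hP1
      ContinuousLinearMap.norm_id_le ?_
    rintro u ⟨f, hu⟩
    rw [tendsto_iff_norm_sub_tendsto_zero]
    refine squeeze_zero (fun _ => norm_nonneg _) (fun t => hPsub t u f hu) ?_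
    have : Continuous fun t : ℝ≥0 => (t : ℝ) * ‖f‖ := by fun_prop
    simpa using this.tendsto 0
  have hmono : ∀ f (s t : ℝ≥0), s ≤ t → ‖P t f - P s f‖ ≤ ‖P (t - s) f - f‖ := fun f s t hst => by
    have : P t f = P s (P (t - s) f) := by
      conv_lhs => rw [← add_tsub_cancel_of_le hst, hPadd]
      rfl
    rw [this, ← map_sub]
    simpa using (P s).le_of_opNorm_le (hP1 s) (P (t - s) f - f)
  have hPcont : ∀ f, Continuous fun t => P t f := fun f => by
    rw [continuous_iff_continuousAt]
    intro s
    rw [ContinuousAt, tendsto_iff_norm_sub_tendsto_zero]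
    refine squeeze_zero (g := fun t => ‖P (t - s) f - f‖ + ‖P (s - t) f - f‖)
      (fun _ => norm_nonneg _) (fun t => ?_) ?_
    · rcases le_total s t with h | h
      · exact (hmono f s t h).trans (le_add_of_nonneg_right (norm_nonneg _))
      · rw [norm_sub_rev]
        exact (hmono f t s h).trans (le_add_of_nonneg_left (norm_nonneg _))
    · have h1 : Tendsto (fun t : ℝ≥0 => t - s) (𝓝 s) (𝓝 0) := by
        have : Continuous fun t : ℝ≥0 => t - s := by fun_prop
        simpa using this.tendsto s
      have h2 : Tendsto (fun t : ℝ≥0 => s - t) (𝓝 s) (𝓝 0) := by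
        have : Continuous fun t : ℝ≥0 => s - t := by fun_prop
        simpa using this.tendsto s
      have h3 := tendsto_iff_norm_sub_tendsto_zero.1 (hPzero f)
      simpa using (h3.comp h1).add (h3.comp h2)
  have hPsymm : ∀ t f g, ⟪P t f, g⟫_ℝ = ⟪f, P t g⟫_ℝ := fun t f g =>
    tendsto_nhds_unique ((hP t f).inner tendsto_const_nhds)
      ((tendsto_const_nhds.inner (hP t g)).congr fun n => (expSemigroup_symm (hB2 n) t f g).symm)
  have hgen : ∀ u f, G u f →
      Tendsto (fun t : ℝ≥0 => (t : ℝ)⁻¹ • (P t u - u)) (𝓝[>] 0) (𝓝 f) := fun u f hu => by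
    -- The limit `n → ∞` of the first-order bound; `g` in the domain will be taken close to `f`.
    have key : ∀ (t : ℝ≥0) (g k : H), G g k → ‖P t u - u - (t : ℝ) • f‖ ≤
        t * (2 * ‖f - g‖ + t * ‖k‖) := fun t g k hg => by
      have h1 := (((hP t u).sub_const u).sub_const ((t : ℝ) • f)).norm
      have h2 : Tendsto (fun n => (t : ℝ) * (‖B n u - f‖ + 2 * ‖f - g‖ + t * ‖B n g‖)) atTop
          (𝓝 (t * (0 + 2 * ‖f - g‖ + t * ‖k‖))) :=
        ((((tendsto_iff_norm_sub_tendsto_zero.1 (hB4 u f hu)).add_const _).add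
          ((hB4 g k hg).norm.const_mul _)).const_mul _)
      rw [zero_add] at h2
      exact le_of_tendsto_of_tendsto h1 h2 (Eventually.of_forall fun n =>
        norm_expSemigroup_sub_sub_le (hB1 n) t.2 u f g)
    rw [Metric.tendsto_nhds]
    intro ε hε
    obtain ⟨g, hgf, k, hg⟩ := Metric.dense_iff.1 hG.dense f (ε / 4) (by positivity)
    rw [Metric.mem_ball, dist_eq_norm, norm_sub_rev] at hgf
    have h1 : ∀ᶠ t : ℝ≥0 in 𝓝[>] 0, (t : ℝ) * ‖k‖ < ε / 2 := by
      have : Continuous fun t : ℝ≥0 => (t : ℝ) * ‖k‖ := by fun_prop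
      have h0 := this.tendsto 0
      rw [NNReal.coe_zero, zero_mul] at h0
      exact (h0.mono_left nhdsWithin_le_nhds).eventually_lt_const (by positivity)
    filter_upwards [h1, self_mem_nhdsWithin] with t ht ht0
    have ht0' : (0 : ℝ) < t := ht0
    have e : (t : ℝ)⁻¹ • (P t u - u) - f = (t : ℝ)⁻¹ • (P t u - u - (t : ℝ) • f) := by
      rw [smul_sub _ (P t u - u), smul_smul, inv_mul_cancel₀ ht0'.ne', one_smul]
    rw [dist_eq_norm, e, norm_smul, norm_inv, Real.norm_of_nonneg ht0'.le]
    calc (t : ℝ)⁻¹ * ‖P t u - u - (t : ℝ) • f‖ ≤ (t : ℝ)⁻¹ * (t * (2 * ‖f - g‖ + t * ‖k‖)) := by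
          gcongr; exact key t g k hg
      _ = 2 * ‖f - g‖ + t * ‖k‖ := by field_simp
      _ < ε := by linarith
  refine ⟨P, hP0, hPadd, hP1, hPsymm, hPcont, fun u f => ⟨fun h => ?_, hgen u f⟩⟩
  -- The generator of a symmetric semigroup is symmetric and, by `hgen`, extends `G`. It is thus
  -- contained in the adjoint of `G`, which is `G`.
  refine hG.of_forall_inner_eq fun v g hv => ?_
  refine tendsto_nhds_unique (h.inner (tendsto_const_nhds (x := v)))
    (((tendsto_const_nhds (x := u)).inner (hgen v g hv)).congr fun t => ?_)
  rw [real_inner_smul_left, real_inner_smul_right, inner_sub_left, inner_sub_right, hPsymm]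

end IsNonposSelfAdjoint

end Generation

/-! ### The evolution equation in integrated form, and its uniqueness. -/

section Semigroup

variable {H : Type*} [NormedAddCommGroup H] [InnerProductSpace ℝ H]

variable {G : H → H → Prop} {P : ℝ≥0 → H →L[ℝ] H}

namespace IsSymmSemigroup

lemma norm_apply_le (hP : IsSymmSemigroup G P) (t : ℝ≥0) (u : H) : ‖P t u‖ ≤ ‖u‖ := by
  simpa using (P t).le_of_opNorm_le (hP.contraction t) u

lemma generator_apply (hP : IsSymmSemigroup G P) (t : ℝ≥0) {u f : H} (hu : G u f) :
    G (P t u) (P t f) := by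
  rw [← hP.generator] at hu ⊢
  refine (((P t).continuous.tendsto f).comp hu).congr fun h => ?_
  have : P h (P t u) = P t (P h u) := by
    rw [← ContinuousLinearMap.comp_apply, ← hP.add, add_comm, hP.add, ContinuousLinearMap.comp_apply]
  simp [this, map_sub]

/-- The generator yields right derivatives directly, and the fundamental theorem of calculus needs
no more. -/
lemma hasDerivWithinAt (hP : IsSymmSemigroup G P) {u f : H} (hu : G u f) {s : ℝ} (hs : 0 ≤ s) :
    HasDerivWithinAt (fun r : ℝ => P r.toNNReal u) (P s.toNNReal f) (Set.Ioi s) s := by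
  rw [hasDerivWithinAt_iff_tendsto_slope' (by simp)]
  have h1 := (hP.generator _ _).2 (hP.generator_apply s.toNNReal hu)
  have h2 : Tendsto (fun r : ℝ => (r - s).toNNReal) (𝓝[>] s) (𝓝[>] 0) := by
    refine tendsto_nhdsWithin_iff.2 ⟨?_, ?_⟩
    · have : Continuous fun r : ℝ => (r - s).toNNReal := by fun_prop
      have h3 := this.tendsto s
      simp only [sub_self, Real.toNNReal_zero] at h3
      exact h3.mono_left nhdsWithin_le_nhds
    · filter_upwards [self_mem_nhdsWithin] with r hr
      simpa using hr
  refine (h1.comp h2).congr' ?_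
  filter_upwards [self_mem_nhdsWithin] with r hr
  have hr' : s < r := hr
  rw [Function.comp_apply, ← ContinuousLinearMap.comp_apply, ← hP.add,
    ← Real.toNNReal_add (by linarith) hs, sub_add_cancel, Real.coe_toNNReal _ (by linarith),
    slope_def_module]

lemma continuous_toNNReal (hP : IsSymmSemigroup G P) (u : H) :
    Continuous fun r : ℝ => P r.toNNReal u :=
  (hP.continuous u).comp continuous_real_toNNReal

lemma apply_sub_inner (hP : IsSymmSemigroup G P) (t : ℝ≥0) {u f : H} (hu : G u f) (v : H) :
    ⟪P t u - u, v⟫_ℝ = ∫ s in (0 : ℝ)..t, ⟪P s.toNNReal f, v⟫_ℝ := by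
  have hc : ∀ w, Continuous fun r : ℝ => ⟪P r.toNNReal w, v⟫_ℝ := fun w =>
    (hP.continuous_toNNReal w).inner continuous_const
  have h := intervalIntegral.integral_eq_sub_of_hasDeriv_right (a := 0) (b := t)
    (hc u).continuousOn (f' := fun r => ⟪P r.toNNReal f, v⟫_ℝ) (fun s hs => ?_)
    ((hc f).intervalIntegrable _ _)
  · rw [h]
    simp [inner_sub_left, hP.zero]
  · rw [min_eq_left (NNReal.coe_nonneg t)] at hs
    simpa using (hP.hasDerivWithinAt hu hs.1.le).inner ℝ (hasDerivWithinAt_const s _ v)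

/-- Symmetry of `P` moves the generator onto the test vector `v`, so `u` may be arbitrary. -/
lemma inner_apply_sub (hP : IsSymmSemigroup G P) (t : ℝ≥0) (u : H) {v g : H} (hv : G v g) :
    ⟪P t u - u, v⟫_ℝ = ∫ s in (0 : ℝ)..t, ⟪P s.toNNReal u, g⟫_ℝ := by
  have e : ∀ r : ℝ≥0, ⟪P r u, g⟫_ℝ = ⟪P r g, u⟫_ℝ := fun r => by rw [hP.symm, real_inner_comm]
  simp_rw [e]
  rw [← hP.apply_sub_inner t hv u, inner_sub_left, inner_sub_left, hP.symm t u v,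
    real_inner_comm (P t v) u, real_inner_comm v u]

end IsSymmSemigroup

/-- Uniqueness of the solution `z` of the evolution equation `z' = Gz`, `z(0) = 0`. -/
lemma IsNonposSelfAdjoint.eq_zero_of_forall_inner [CompleteSpace H] (hG : IsNonposSelfAdjoint G)
    {z : ℝ≥0 → H} (hz : Continuous z)
    (h : ∀ t v g, G v g → ⟪z t, v⟫_ℝ = ∫ s in (0 : ℝ)..t, ⟪z s.toNNReal, g⟫_ℝ) (t : ℝ≥0) :
    z t = 0 := by
  have hc : Continuous fun s : ℝ => z s.toNNReal := hz.comp continuous_real_toNNReal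
  -- Integration in time gains regularity: `z` need not be in the domain of `G`, but `Z` is, with `G
  -- Z = z = Z'`.
  let Z : ℝ → H := fun t => ∫ s in (0 : ℝ)..t, z s.toNNReal
  have hZ : ∀ t, HasDerivAt Z (z t.toNNReal) t := fun t =>
    hc.integral_hasStrictDerivAt 0 t |>.hasDerivAt
  have hGZ : ∀ t : ℝ, 0 ≤ t → G (Z t) (z t.toNNReal) := fun t ht => by
    refine hG.of_forall_inner_eq fun v g hv => ?_
    rw [h _ v g hv, Real.coe_toNNReal _ ht]
    have := (innerSL ℝ g).intervalIntegral_comp_comm (hc.intervalIntegrable (μ := volume) 0 t)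
    simp only [innerSL_apply_apply] at this
    rw [real_inner_comm, ← this]
    simp_rw [real_inner_comm g]
  have hd : ∀ s, HasDerivAt (fun s => ‖Z s‖ ^ 2) (2 * ⟪Z s, z s.toNNReal⟫_ℝ) s := fun s =>
    (hZ s).norm_sq
  have ha : AntitoneOn (fun s => ‖Z s‖ ^ 2) (Set.Ici 0) := by
    refine antitoneOn_of_deriv_nonpos (convex_Ici 0)
      (fun s _ => (hd s).continuousAt.continuousWithinAt)
      (fun s _ => (hd s).differentiableAt.differentiableWithinAt) fun s hs => ?_
    rw [interior_Ici] at hs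
    rw [(hd s).deriv, real_inner_comm]
    linarith [hG.nonpos (hGZ s (le_of_lt hs))]
  have hZ0 : Z t = 0 := by
    have := ha (Set.mem_Ici.2 le_rfl) (Set.mem_Ici.2 t.2) t.2
    have h0 : Z 0 = 0 := by simp [Z]
    simp only [h0] at this
    have h1 := le_of_sq_le_sq this (norm_nonneg _)
    exact norm_le_zero_iff.1 (h1.trans (by simp))
  have h1 := hGZ t t.2
  change G (Z (t : ℝ)) _ at h1
  rw [hZ0, Real.toNNReal_coe] at h1
  refine hG.eq_of_eq h1 ?_
  simpa using hG.smul 0 h1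

lemma IsNonposSelfAdjoint.semigroup_unique [CompleteSpace H] (hG : IsNonposSelfAdjoint G)
    {Q : ℝ≥0 → H →L[ℝ] H} (hP : IsSymmSemigroup G P) (hQ : IsSymmSemigroup G Q) : P = Q := by
  ext t u
  refine sub_eq_zero.1 (hG.eq_zero_of_forall_inner (z := fun t => P t u - Q t u)
    ((hP.continuous u).sub (hQ.continuous u)) (fun t v g hv => ?_) t)
  have e : P t u - Q t u = (P t u - u) - (Q t u - u) := by abel
  simp only [e, inner_sub_left (P t u - u), hP.inner_apply_sub t u hv, hQ.inner_apply_sub t u hv]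
  rw [← intervalIntegral.integral_sub]
  · simp only [inner_sub_left]
  · exact ((hP.continuous_toNNReal u).inner continuous_const).intervalIntegrable _ _
  · exact ((hQ.continuous_toNNReal u).inner continuous_const).intervalIntegrable _ _

end Semigroup

/-! ### The operator of a closed form -/

section Form

variable {H H' : Type*} [NormedAddCommGroup H] [InnerProductSpace ℝ H]
  [NormedAddCommGroup H'] [InnerProductSpace ℝ H']

/-- The graph of `-T*T`, for the operator `T` with graph `K`. -/
def FormGenerator (K : Submodule ℝ (H × H')) (u f : H) : Prop :=
  ∃ w, (u, w) ∈ K ∧ ∀ p ∈ K, ⟪w, p.2⟫_ℝ = -⟪f, p.1⟫_ℝ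

variable {K : Submodule ℝ (H × H')}

/-- The variational problem `u + h T*T u = f`. -/
lemma exists_variational [CompleteSpace H] [CompleteSpace H'] (hK : IsClosed (K : Set (H × H')))
    {h : ℝ} (hh : 0 < h) (f : H) :
    ∃ u w, (u, w) ∈ K ∧ ∀ p ∈ K, ⟪u, p.1⟫_ℝ + h * ⟪w, p.2⟫_ℝ = ⟪f, p.1⟫_ℝ := by
  let c := √h
  have hc : c ≠ 0 := (Real.sqrt_pos.2 hh).ne'
  -- the graph of `√h T` in the Hilbert sum
  let S : WithLp 2 (H × H') →L[ℝ] H × H' :=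
    ((ContinuousLinearMap.fst ℝ H H').prod (c⁻¹ • ContinuousLinearMap.snd ℝ H H')).comp
      (WithLp.prodContinuousLinearEquiv 2 ℝ H H' : WithLp 2 (H × H') →L[ℝ] H × H')
  let L : Submodule ℝ (WithLp 2 (H × H')) := K.comap (S : WithLp 2 (H × H') →ₗ[ℝ] H × H')
  have hL : IsClosed (L : Set (WithLp 2 (H × H'))) := hK.preimage S.continuous
  have : CompleteSpace L := hL.completeSpace_coe
  -- Orthogonality of `(f, 0) - q` to every `(p.1, √h p.2)` is the variational equation. The second
  -- component of `q` is `√h w`, whence the witness `c⁻¹ • q.snd`.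
  let q := L.starProjection (WithLp.toLp 2 (f, (0 : H')))
  have hq : q ∈ L := Submodule.starProjection_apply_mem _ _
  refine ⟨q.fst, c⁻¹ • q.snd, hq, fun p hp => ?_⟩
  have hmem : WithLp.toLp 2 (p.1, c • p.2) ∈ L := by
    change (p.1, c⁻¹ • c • p.2) ∈ K
    rwa [smul_smul, inv_mul_cancel₀ hc, one_smul]
  have := Submodule.starProjection_inner_eq_zero (K := L) (WithLp.toLp 2 (f, (0 : H'))) _ hmem
  change inner ℝ (WithLp.toLp 2 (f, (0 : H')) - q) _ = 0 at this
  rw [inner_sub_left, WithLp.prod_inner_apply, WithLp.prod_inner_apply] at this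
  simp only [inner_zero_left, inner_smul_right] at this
  have h2 : c * c = h := Real.mul_self_sqrt hh.le
  rw [inner_smul_left, ← h2]
  change ⟪f, p.1⟫_ℝ + c * 0 - (⟪q.fst, p.1⟫_ℝ + c * ⟪q.snd, p.2⟫_ℝ) = 0 at this
  simp only [RCLike.conj_to_real]
  have h3 : c * c * (c⁻¹ * ⟪q.snd, p.2⟫_ℝ) = c * ⟪q.snd, p.2⟫_ℝ := by field_simp
  rw [h3]
  linarith

/-- Surjectivity is the variational problem. For density, let `f` be orthogonal to the domain and
solve `u + T*T u = f`: then `‖u‖² + ‖T u‖² = ⟪f, u⟫ = 0`, so the equation says that `f` is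
orthogonal to the dense domain of `T`. -/
lemma isNonposSelfAdjoint_formGenerator [CompleteSpace H] [CompleteSpace H']
    (hK : IsClosed (K : Set (H × H'))) (hd : Dense {u | ∃ w, (u, w) ∈ K}) :
    IsNonposSelfAdjoint (FormGenerator K) where
  add := by
    rintro u f v g ⟨w, hw, hwf⟩ ⟨w', hw', hwf'⟩
    refine ⟨w + w', K.add_mem hw hw', fun p hp => ?_⟩
    rw [inner_add_left, inner_add_left, hwf p hp, hwf' p hp]; ring
  smul := by
    rintro r u f ⟨w, hw, hwf⟩
    refine ⟨r • w, K.smul_mem r hw, fun p hp => ?_⟩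
    rw [inner_smul_left, inner_smul_left, hwf p hp]; ring
  nonpos := by
    rintro u f ⟨w, hw, hwf⟩
    have := hwf _ hw
    linarith [real_inner_self_nonneg (x := w)]
  symm := by
    rintro u f v g ⟨w, hw, hwf⟩ ⟨w', hw', hwf'⟩
    have h1 := hwf _ hw'
    have h2 := hwf' _ hw
    simp only at h1 h2
    rw [real_inner_comm u, real_inner_comm w] at h2
    linarith
  surj := by
    intro h hh f
    obtain ⟨u, w, hw, hu⟩ := exists_variational hK hh f
    refine ⟨u, h⁻¹ • (u - f), ⟨w, hw, fun p hp => ?_⟩, ?_⟩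
    · have := hu p hp
      rw [inner_smul_left, inner_sub_left, ← this]
      simp only [RCLike.conj_to_real]
      field_simp
      ring
    · rw [smul_smul, mul_inv_cancel₀ hh.ne', one_smul]; abel
  dense := by
    have hr : ∀ f, ∃ u w, (u, w) ∈ K ∧ ∀ p ∈ K, ⟪u, p.1⟫_ℝ + 1 * ⟪w, p.2⟫_ℝ = ⟪f, p.1⟫_ℝ := fun f =>
      exists_variational hK one_pos f
    let D : Submodule ℝ H :=
      { carrier := {u | ∃ f, FormGenerator K u f}
        zero_mem' := ⟨0, 0, K.zero_mem, by simp⟩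
        add_mem' := by
          rintro u v ⟨f, w, hw, hwf⟩ ⟨g, w', hw', hwf'⟩
          refine ⟨f + g, w + w', K.add_mem hw hw', fun p hp => ?_⟩
          rw [inner_add_left, inner_add_left, hwf p hp, hwf' p hp]; ring
        smul_mem' := by
          rintro r u ⟨f, w, hw, hwf⟩
          refine ⟨r • f, r • w, K.smul_mem r hw, fun p hp => ?_⟩
          rw [inner_smul_left, inner_smul_left, hwf p hp]; ring }
    change Dense (D : Set H)
    rw [Submodule.dense_iff_topologicalClosure_eq_top, Submodule.topologicalClosure_eq_top_iff,
      Submodule.eq_bot_iff]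
    intro f hf
    obtain ⟨u, w, hw, hu⟩ := hr f
    have hD : u ∈ D := ⟨u - f, w, hw, fun p hp => by
      have := hu p hp
      rw [inner_sub_left, ← this]; ring⟩
    have h1 := hu _ hw
    have h2 : ⟪f, u⟫_ℝ = 0 := by rw [real_inner_comm]; exact hf u hD
    simp only [h2, one_mul] at h1
    have h3 := real_inner_self_nonneg (x := u)
    have h4 := real_inner_self_nonneg (x := w)
    have hu0 : u = 0 := inner_self_eq_zero (𝕜 := ℝ).1 (by linarith)
    have hw0 : w = 0 := inner_self_eq_zero (𝕜 := ℝ).1 (by linarith)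
    refine hd.eq_zero_of_inner_left (𝕜 := ℝ) fun v hv => ?_
    obtain ⟨z, hz⟩ := hv
    have := hu _ hz
    simpa [hu0, hw0] using this.symm

/-- The domain of the operator is a core of the form. -/
lemma exists_formGenerator_tendsto [CompleteSpace H] [CompleteSpace H']
    (hK : IsClosed (K : Set (H × H'))) (hs : ∀ w, ((0 : H), w) ∈ K → w = 0) {p : H × H'}
    (hp : p ∈ K) :
    ∃ q : ℕ → H × H', (∀ n, q n ∈ K) ∧
      (∀ n, ∃ f, ∀ r ∈ K, ⟪(q n).2, r.2⟫_ℝ = -⟪f, r.1⟫_ℝ) ∧ Tendsto q atTop (𝓝 p) := by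
  let S := (WithLp.prodContinuousLinearEquiv 2 ℝ H H').symm
  let D : Submodule ℝ (WithLp 2 (H × H')) :=
    { carrier := {q | (q.fst, q.snd) ∈ K ∧ ∃ f, ∀ r ∈ K, ⟪q.snd, r.2⟫_ℝ = -⟪f, r.1⟫_ℝ}
      zero_mem' := ⟨K.zero_mem, 0, by simp⟩
      add_mem' := by
        rintro q q' ⟨hq, f, hf⟩ ⟨hq', f', hf'⟩
        refine ⟨K.add_mem hq hq', f + f', fun r hr => ?_⟩
        rw [WithLp.add_snd, inner_add_left, inner_add_left, hf r hr, hf' r hr]; ring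
      smul_mem' := by
        rintro c q ⟨hq, f, hf⟩
        refine ⟨K.smul_mem c hq, c • f, fun r hr => ?_⟩
        rw [WithLp.smul_snd, inner_smul_left, inner_smul_left, hf r hr]; ring }
  have hmem : S p ∈ closure (D : Set (WithLp 2 (H × H'))) := by
    rw [← Submodule.topologicalClosure_coe]
    let C := D.topologicalClosure
    have : CompleteSpace C := D.isClosed_topologicalClosure.completeSpace_coe
    let q := C.starProjection (S p)
    have hq : q ∈ C := Submodule.starProjection_apply_mem _ _
    have hCK : (q.fst, q.snd) ∈ K := by
      have hcl : IsClosed {q : WithLp 2 (H × H') | (q.fst, q.snd) ∈ (K : Set (H × H'))} :=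
        hK.preimage (WithLp.prodContinuousLinearEquiv 2 ℝ H H').continuous
      exact closure_minimal (fun q hq => hq.1) hcl hq
    have hpq : S p - q = 0 := by
      have h1 : (p.1 - q.fst, p.2 - q.snd) ∈ K := K.sub_mem hp hCK
      -- The residual of the projection lies in `K` and is orthogonal to each solution of the
      -- variational problem, so its first component is orthogonal to every datum `f`, itself
      -- included. Then `hs` removes the second component.
      have h2 : ∀ f u w, (u, w) ∈ K →
          (∀ r ∈ K, ⟪u, r.1⟫_ℝ + 1 * ⟪w, r.2⟫_ℝ = ⟪f, r.1⟫_ℝ) → ⟪f, p.1 - q.fst⟫_ℝ = 0 := by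
        intro f u w huw hr
        have h3 : WithLp.toLp 2 (u, w) ∈ C := D.le_topologicalClosure ⟨huw, u - f, fun r hrK => by
          have := hr r hrK
          change ⟪w, r.2⟫_ℝ = _
          rw [inner_sub_left, ← this]; ring⟩
        have h4 := Submodule.starProjection_inner_eq_zero (K := C) (S p) _ h3
        rw [WithLp.prod_inner_apply] at h4
        change ⟪p.1 - q.fst, u⟫_ℝ + ⟪p.2 - q.snd, w⟫_ℝ = 0 at h4
        have h5 := hr _ h1
        rw [real_inner_comm, real_inner_comm w] at h4
        simp only [one_mul] at h5
        rw [← h5, h4]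
      have h3 : p.1 - q.fst = 0 := by
        obtain ⟨u, w, huw, hr⟩ := exists_variational hK one_pos (p.1 - q.fst)
        exact inner_self_eq_zero (𝕜 := ℝ).1 (h2 _ u w huw hr)
      rw [h3] at h1
      have h4 := hs _ h1
      refine (WithLp.prodContinuousLinearEquiv 2 ℝ H H').injective ?_
      exact Prod.ext h3 h4
    rw [sub_eq_zero.1 hpq]
    exact hq
  obtain ⟨q, hqD, hq⟩ := mem_closure_iff_seq_limit.1 hmem
  refine ⟨fun n => ((q n).fst, (q n).snd), fun n => (hqD n).1, fun n => (hqD n).2, ?_⟩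
  exact ((WithLp.prodContinuousLinearEquiv 2 ℝ H H').continuous.tendsto _).comp hq

end Form

/-! ### Evolution of the form domain under the semigroup. -/

section FormEvolution

variable {H H' : Type*} [NormedAddCommGroup H] [InnerProductSpace ℝ H]
  [NormedAddCommGroup H'] [InnerProductSpace ℝ H']

variable {K : Submodule ℝ (H × H')} {P : ℝ≥0 → H →L[ℝ] H}

lemma IsSymmSemigroup.inner_apply_self_nonneg {G : H → H → Prop} (hP : IsSymmSemigroup G P)
    (t : ℝ≥0) (f : H) : 0 ≤ ⟪P t f, f⟫_ℝ := by
  rw [← add_halves t, hP.add, ContinuousLinearMap.comp_apply, hP.symm]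
  exact real_inner_self_nonneg

/-- The form decreases along the semigroup. -/
lemma FormGenerator.norm_le (hP : IsSymmSemigroup (FormGenerator K) P) {u f : H} {w w' : H'}
    (hw : (u, w) ∈ K) (hwf : ∀ p ∈ K, ⟪w, p.2⟫_ℝ = -⟪f, p.1⟫_ℝ) {t : ℝ≥0} (hw' : (P t u, w') ∈ K)
    (hwf' : ∀ p ∈ K, ⟪w', p.2⟫_ℝ = -⟪P t f, p.1⟫_ℝ) : ‖w'‖ ≤ ‖w‖ := by
  refine le_of_sq_le_sq ?_ (norm_nonneg _)
  rw [← real_inner_self_eq_norm_sq, ← real_inner_self_eq_norm_sq]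
  have h1 := hwf _ hw
  have h2 := hwf' _ hw'
  simp only at h1 h2
  -- `‖w‖² - ‖w'‖² = ⟪P_t f, P_t u⟫ - ⟪f, u⟫ = ⟪P_{2t} f - f, u⟫ = ∫₀^{2t} ⟪P_s f, f⟫ ds`, and the
  -- integrand is nonnegative.
  have h3 := hP.inner_apply_sub (t + t) f ⟨w, hw, hwf⟩
  rw [inner_sub_left, hP.add, ContinuousLinearMap.comp_apply, hP.symm] at h3
  have h4 : 0 ≤ ∫ s in (0 : ℝ)..↑(t + t), ⟪P s.toNNReal f, f⟫_ℝ :=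
    intervalIntegral.integral_nonneg (NNReal.coe_nonneg _) fun s _ =>
      hP.inner_apply_self_nonneg _ _
  linarith

/-- Continuity of `W` comes from `‖W t - W s‖² = -⟪P_t f - P_s f, P_t u - P_s u⟫`. -/
lemma FormGenerator.exists_evolution (hP : IsSymmSemigroup (FormGenerator K) P) {u f : H} {w : H'}
    (hw : (u, w) ∈ K) (hwf : ∀ p ∈ K, ⟪w, p.2⟫_ℝ = -⟪f, p.1⟫_ℝ) :
    ∃ W : ℝ≥0 → H', Continuous W ∧ (∀ t, (P t u, W t) ∈ K) ∧
      (∀ t, ∀ p ∈ K, ⟪W t, p.2⟫_ℝ = -⟪P t f, p.1⟫_ℝ) ∧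
      ∀ p ∈ K, ∀ t : ℝ≥0, ⟪P t u - u, p.1⟫_ℝ = -∫ s in (0 : ℝ)..t, ⟪W s.toNNReal, p.2⟫_ℝ := by
  have hu : FormGenerator K u f := ⟨w, hw, hwf⟩
  choose W hWK hWf using fun t => hP.generator_apply t hu
  refine ⟨W, ?_, hWK, hWf, fun p hp t => ?_⟩
  · rw [continuous_iff_continuousAt]
    intro s
    rw [ContinuousAt, tendsto_iff_norm_sub_tendsto_zero]
    have key : ∀ t, ‖W t - W s‖ ^ 2 ≤ ‖P t f - P s f‖ * ‖P t u - P s u‖ := fun t => by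
      have h1 := K.sub_mem (hWK t) (hWK s)
      have h2 := hWf t _ h1
      have h3 := hWf s _ h1
      simp only [Prod.fst_sub, Prod.snd_sub] at h2 h3
      rw [← real_inner_self_eq_norm_sq, inner_sub_left, h2, h3, ← norm_neg (P t f - P s f)]
      refine le_trans (le_of_eq ?_) (real_inner_le_norm _ _)
      rw [inner_neg_left, inner_sub_left]; ring
    have h0 : Tendsto (fun t => ‖P t f - P s f‖ * ‖P t u - P s u‖) (𝓝 s) (𝓝 0) := by
      have h1 := tendsto_iff_norm_sub_tendsto_zero.1 ((hP.continuous f).tendsto s)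
      have h2 := tendsto_iff_norm_sub_tendsto_zero.1 ((hP.continuous u).tendsto s)
      simpa using h1.mul h2
    have h1 := (squeeze_zero (fun _ => sq_nonneg _) key h0).sqrt
    simpa [Real.sqrt_sq (norm_nonneg _)] using h1
  · rw [hP.apply_sub_inner t hu, ← intervalIntegral.integral_neg]
    simp_rw [hWf _ p hp, neg_neg]

/-- The evolution of an element of the form domain. -/
theorem exists_form_evolution [CompleteSpace H] [CompleteSpace H']
    (hK : IsClosed (K : Set (H × H'))) (hs : ∀ w, ((0 : H), w) ∈ K → w = 0)
    (hP : IsSymmSemigroup (FormGenerator K) P) {u : H} {w : H'} (hu : (u, w) ∈ K) :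
    ∃ W : ℝ≥0 → H', Continuous W ∧ (∀ t, (P t u, W t) ∈ K) ∧ (∀ t, ‖W t‖ ≤ ‖w‖) ∧
      ∀ p ∈ K, ∀ t : ℝ≥0, ⟪P t u - u, p.1⟫_ℝ = -∫ s in (0 : ℝ)..t, ⟪W s.toNNReal, p.2⟫_ℝ := by
  obtain ⟨q, hqK, hqf, hq⟩ := exists_formGenerator_tendsto hK hs hu
  choose f hf using hqf
  choose W hWc hWK hWf hWi using fun n => FormGenerator.exists_evolution hP (hqK n) (hf n)
  have hq1 : Tendsto (fun n => (q n).1) atTop (𝓝 u) := (continuous_fst.tendsto _).comp hq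
  have hq2 : Tendsto (fun n => (q n).2) atTop (𝓝 w) := (continuous_snd.tendsto _).comp hq
  have hle : ∀ n t, ‖W n t‖ ≤ ‖(q n).2‖ := fun n t =>
    FormGenerator.norm_le hP (hqK n) (hf n) (hWK n t) (hWf n t)
  -- Decrease of the energy, applied to differences, makes the convergence uniform in `t`;
  -- continuity of the limit and the integral identity follow.
  have hdiff : ∀ n m t, ‖W n t - W m t‖ ≤ ‖(q n).2 - (q m).2‖ := fun n m t => by
    refine FormGenerator.norm_le hP (f := f n - f m) (K.sub_mem (hqK n) (hqK m)) (fun p hp => ?_)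
      (t := t) ?_ fun p hp => ?_
    · rw [inner_sub_left, inner_sub_left, hf n p hp, hf m p hp]; ring
    · rw [map_sub]
      exact K.sub_mem (hWK n t) (hWK m t)
    · rw [map_sub, inner_sub_left, inner_sub_left, hWf n t p hp, hWf m t p hp]; ring
  have hcauchy : ∀ t, CauchySeq fun n => W n t := fun t => by
    rw [Metric.cauchySeq_iff]
    intro ε hε
    obtain ⟨N, hN⟩ := Metric.cauchySeq_iff.1 hq2.cauchySeq ε hε
    refine ⟨N, fun m hm n hn => ?_⟩
    have := hN m hm n hn
    rw [dist_eq_norm] at this ⊢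
    exact (hdiff m n t).trans_lt this
  choose V hV using fun t => cauchySeq_tendsto_of_complete (hcauchy t)
  have hunif : ∀ n t, ‖W n t - V t‖ ≤ ‖(q n).2 - w‖ := fun n t =>
    le_of_tendsto_of_tendsto (tendsto_const_nhds.sub (hV t)).norm
      (tendsto_const_nhds.sub hq2).norm (Eventually.of_forall fun m => hdiff n m t)
  have hVc : Continuous V := by
    refine TendstoUniformly.continuous (F := W) (p := atTop) ?_ (Frequently.of_forall hWc)
    rw [Metric.tendstoUniformly_iff]
    intro ε hε
    filter_upwards [Metric.tendsto_nhds.1 hq2 ε hε] with n hn t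
    rw [dist_eq_norm] at hn
    rw [dist_comm, dist_eq_norm]
    exact (hunif n t).trans_lt hn
  refine ⟨V, hVc, fun t => ?_, fun t => ?_, fun p hp t => ?_⟩
  · exact hK.mem_of_tendsto ((((P t).continuous.tendsto u).comp hq1).prodMk_nhds (hV t))
      (Eventually.of_forall fun n => hWK n t)
  · exact le_of_tendsto_of_tendsto (hV t).norm hq2.norm (Eventually.of_forall fun n => hle n t)
  · have h1 : Tendsto (fun n => ⟪P t (q n).1 - (q n).1, p.1⟫_ℝ) atTop (𝓝 ⟪P t u - u, p.1⟫_ℝ) :=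
      ((((P t).continuous.tendsto u).comp hq1).sub hq1).inner tendsto_const_nhds
    refine tendsto_nhds_unique h1 ?_
    simp_rw [hWi _ p hp t]
    refine Tendsto.neg ?_
    rw [tendsto_iff_norm_sub_tendsto_zero]
    have hint : ∀ X : ℝ≥0 → H', Continuous X →
        IntervalIntegrable (fun s : ℝ => ⟪X s.toNNReal, p.2⟫_ℝ) volume 0 t := fun X hX =>
      ((hX.comp continuous_real_toNNReal).inner continuous_const).intervalIntegrable _ _
    refine squeeze_zero (g := fun n => ‖(q n).2 - w‖ * ‖p.2‖ * t) (fun _ => norm_nonneg _)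
      (fun n => ?_) ?_
    · rw [← intervalIntegral.integral_sub (hint _ (hWc n)) (hint _ hVc)]
      refine (intervalIntegral.norm_integral_le_of_norm_le_const
        (C := ‖(q n).2 - w‖ * ‖p.2‖) fun s _ => ?_).trans_eq ?_
      · rw [← inner_sub_left]
        exact (norm_inner_le_norm _ _).trans (by gcongr; exact hunif n _)
      · simp
    · have := ((tendsto_iff_norm_sub_tendsto_zero.1 hq2).mul_const ‖p.2‖).mul_const (t : ℝ)
      simpa using this

end FormEvolution

/-! ### Absolutely continuous functions on the line -/

section AbsCont

variable {f g : ℝ → ℝ}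

lemma continuous_of_absCont (hf : ∀ x y, AbsolutelyContinuousOnInterval f x y) : Continuous f := by
  rw [continuous_iff_continuousAt]
  intro x
  refine (hf (x - 1) (x + 1)).continuousOn.continuousAt ?_
  rw [Set.uIcc_of_le (by linarith)]
  exact Icc_mem_nhds (by linarith) (by linarith)

lemma ae_differentiableAt_of_absCont (hf : ∀ x y, AbsolutelyContinuousOnInterval f x y) :
    ∀ᵐ x, DifferentiableAt ℝ f x := by
  have h : ∀ n : ℕ, ∀ᵐ x, x ∈ Set.uIcc (-n : ℝ) n → DifferentiableAt ℝ f x := fun n =>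
    (hf _ _).ae_differentiableAt
  filter_upwards [ae_all_iff.2 h] with x hx
  obtain ⟨n, hn⟩ := exists_nat_ge |x|
  refine hx n ?_
  rw [Set.uIcc_of_le (by linarith [abs_nonneg x])]
  exact abs_le.1 hn

lemma absCont_primitive {w : ℝ → ℝ} (hw : LocallyIntegrable w) (c k : ℝ) (x y : ℝ) :
    AbsolutelyContinuousOnInterval (fun x => k + ∫ t in c..x, w t) x y := by
  -- The interval is enlarged so as to contain the base point `c`.
  have h1 : AbsolutelyContinuousOnInterval (fun x => ∫ t in c..x, w t)
      (min c (min x y)) (max c (max x y)) :=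
    (hw.integrableOn_isCompact isCompact_uIcc).intervalIntegrable.absolutelyContinuousOnInterval_intervalIntegral
      ⟨by simp, by simp⟩
  have h2 : AbsolutelyContinuousOnInterval (fun _ : ℝ => k) x y :=
    (LipschitzWith.const k).lipschitzOnWith.absolutelyContinuousOnInterval
  refine h2.add (h1.mono ?_)
  rw [Set.uIcc, Set.uIcc]
  refine Set.Icc_subset_Icc ?_ ?_ <;> simp

lemma ae_hasDerivAt_primitive {w : ℝ → ℝ} (hw : LocallyIntegrable w) (c k : ℝ) :
    ∀ᵐ x, HasDerivAt (fun x => k + ∫ t in c..x, w t) (w x) x := by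
  filter_upwards [LocallyIntegrable.ae_hasDerivAt_integral hw] with x hx
  exact (hx c).const_add k

lemma deriv_primitive_ae_eq {w : ℝ → ℝ} (hw : LocallyIntegrable w) (c k : ℝ) :
    deriv (fun x => k + ∫ t in c..x, w t) =ᵐ[volume] w := by
  filter_upwards [ae_hasDerivAt_primitive hw c k] with x hx
  exact hx.deriv

lemma deriv_mul_ae_eq (hf : ∀ x y, AbsolutelyContinuousOnInterval f x y)
    (hg : ∀ x y, AbsolutelyContinuousOnInterval g x y) :
    deriv (f * g) =ᵐ[volume] fun x => deriv f x * g x + f x * deriv g x := by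
  filter_upwards [ae_differentiableAt_of_absCont hf, ae_differentiableAt_of_absCont hg]
    with x h1 h2
  exact (h1.hasDerivAt.mul h2.hasDerivAt).deriv

/-- Integrability of `f'` gives `f` limits at both ends, and integrability of `f` forces them to be
`0`. -/
lemma integral_deriv_eq_zero_of_absCont (hf : ∀ x y, AbsolutelyContinuousOnInterval f x y)
    (hi : Integrable f) (hd : Integrable (deriv f)) : ∫ x, deriv f x = 0 := by
  have h1 : Tendsto f atTop (𝓝 (f 0 + ∫ x in Set.Ioi 0, deriv f x)) := by
    refine ((intervalIntegral_tendsto_integral_Ioi 0 hd.integrableOn tendsto_id).const_add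
      (f 0)).congr fun x => ?_
    rw [(hf 0 _).integral_deriv_eq_sub]; simp
  have h2 : Tendsto f atBot (𝓝 (f 0 - ∫ x in Set.Iic 0, deriv f x)) := by
    refine ((intervalIntegral_tendsto_integral_Iic 0 hd.integrableOn tendsto_id).const_sub
      (f 0)).congr fun x => ?_
    rw [(hf _ 0).integral_deriv_eq_sub]; simp
  have h3 := (hi.integrableAtFilter atTop).eq_zero_of_tendsto (fun s hs => by
    obtain ⟨a, ha⟩ := mem_atTop_sets.1 hs
    exact top_unique (Real.volume_Ici (a := a) ▸ measure_mono ha)) h1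
  have h4 := (hi.integrableAtFilter atBot).eq_zero_of_tendsto (fun s hs => by
    obtain ⟨a, ha⟩ := mem_atBot_sets.1 hs
    exact top_unique (Real.volume_Iic (a := a) ▸ measure_mono ha)) h2
  rw [← integral_add_compl measurableSet_Iic hd, Set.compl_Iic]
  linarith

end AbsCont

/-! ### Test functions -/

section Test

/-- Smooth functions with compact support. -/
def IsTest (g : ℝ → ℝ) : Prop := ContDiff ℝ (⊤ : ℕ∞) g ∧ HasCompactSupport g

variable {g : ℝ → ℝ}

lemma IsTest.absCont (hg : IsTest g) (x y : ℝ) : AbsolutelyContinuousOnInterval g x y :=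
  (hg.1.of_le (by exact_mod_cast le_top)).contDiffOn.absolutelyContinuousOnInterval

lemma IsTest.deriv (hg : IsTest g) : IsTest (deriv g) :=
  ⟨(contDiff_infty_iff_deriv.1 hg.1).2, hg.2.deriv⟩

lemma IsTest.memLp (hg : IsTest g) (p : ℝ≥0∞) : MemLp g p volume :=
  hg.1.continuous.memLp_of_hasCompactSupport hg.2

lemma IsTest.memH1 (hg : IsTest g) : MemH1 g := ⟨hg.memLp 2, hg.absCont, hg.deriv.memLp 2⟩

/-- The primitive started left of the support equals the total integral, zero, to the right of it.
-/
lemma IsTest.exists_deriv_eq (hg : IsTest g) (h0 : ∫ x, g x = 0) :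
    ∃ φ, IsTest φ ∧ _root_.deriv φ = g := by
  obtain ⟨R, hR⟩ := hg.2.isCompact.isBounded.subset_closedBall 0
  have hsupp : ∀ x, R < |x| → g x = 0 := fun x hx => by
    by_contra h
    have := hR (subset_tsupport g h)
    rw [mem_closedBall_zero_iff, Real.norm_eq_abs] at this
    linarith
  let S := |R| + 1
  have hS : R < S := by have := le_abs_self R; simp only [S]; linarith
  have hS0 : 0 < S := by positivity
  have hd : ∀ x, HasDerivAt (fun x => ∫ t in (-S)..x, g t) (g x) x := fun x =>
    (hg.1.continuous.integral_hasStrictDerivAt _ x).hasDerivAt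
  have hdd : _root_.deriv (fun x => ∫ t in (-S)..x, g t) = g := funext fun x => (hd x).deriv
  refine ⟨fun x => ∫ t in (-S)..x, g t, ⟨?_, ?_⟩, hdd⟩
  · rw [contDiff_infty_iff_deriv, hdd]
    exact ⟨fun x => (hd x).differentiableAt, hg.1⟩
  · refine HasCompactSupport.of_support_subset_isCompact (isCompact_Icc (a := -S) (b := S))
      fun x hx => ?_
    by_contra hxS
    refine hx ?_
    rw [Set.mem_Icc, not_and_or, not_le, not_le] at hxS
    rcases hxS with h | h
    · refine intervalIntegral.integral_zero_ae (Eventually.of_forall fun t ht => hsupp t ?_)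
      rw [Set.uIoc_of_ge h.le] at ht
      have := neg_abs_le t
      linarith [ht.2]
    · change ∫ t in (-S)..x, g t = 0
      rw [intervalIntegral.integral_eq_integral_of_support_subset, h0]
      intro t ht
      have h1 : |t| ≤ R := by
        by_contra h2
        exact ht (hsupp t (not_le.1 h2))
      have := abs_le.1 h1
      constructor <;> linarith

lemma memLp_mul_integrable {f g : ℝ → ℝ} (hf : MemLp f 2 volume) (hg : MemLp g 2 volume) :
    Integrable (fun x => f x * g x) := hf.integrable_mul hg

/-- The du Bois-Reymond lemma. -/
lemma exists_primitive_of_weakDeriv {α β : ℝ → ℝ} (hα : MemLp α 2 volume) (hβ : MemLp β 2 volume)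
    (h : ∀ g, IsTest g → ∫ x, (α x * g x + β x * _root_.deriv g x) = 0) :
    ∃ B : ℝ → ℝ, (∀ x y, AbsolutelyContinuousOnInterval B x y) ∧ β =ᵐ[volume] B ∧
      _root_.deriv B =ᵐ[volume] α := by
  have hαl : LocallyIntegrable α := hα.locallyIntegrable (by norm_num)
  have hβl : LocallyIntegrable β := hβ.locallyIntegrable (by norm_num)
  let A : ℝ → ℝ := fun x => 0 + ∫ t in (0 : ℝ)..x, α t
  have hA : ∀ x y, AbsolutelyContinuousOnInterval A x y := absCont_primitive hαl 0 0
  have hAd : _root_.deriv A =ᵐ[volume] α := deriv_primitive_ae_eq hαl 0 0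
  have hAc : Continuous A := continuous_of_absCont hA
  have hl : LocallyIntegrable (fun x => β x - A x) := hβl.sub hAc.locallyIntegrable
  have hint : ∀ g, IsTest g → Integrable fun x => (β x - A x) * g x := fun g hg => by
    have := hl.integrable_smul_left_of_hasCompactSupport hg.1.continuous hg.2
    simpa [smul_eq_mul, mul_comm] using this
  have hAint : ∀ g, IsTest g → Integrable fun x => A x * g x := fun g hg => by
    have := hAc.locallyIntegrable (μ := volume).integrable_smul_left_of_hasCompactSupport
      hg.1.continuous hg.2
    simpa [smul_eq_mul, mul_comm] using this
  -- Subtracting the primitive `A` of `α` reduces to the case of zero weak derivative.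
  have hzero : ∀ g, IsTest g → ∫ x, (β x - A x) * _root_.deriv g x = 0 := fun g hg => by
    have h1 := deriv_mul_ae_eq hA hg.absCont
    have h2 : _root_.deriv (A * g) =ᵐ[volume] fun x => α x * g x + A x * _root_.deriv g x := by
      filter_upwards [h1, hAd] with x h1 h2
      rw [h1, h2]
    have h3 : Integrable fun x => α x * g x + A x * _root_.deriv g x :=
      (memLp_mul_integrable hα (hg.memLp 2)).add (hAint _ hg.deriv)
    have h4 := integral_deriv_eq_zero_of_absCont
      (fun x y => (hA x y).mul (hg.absCont x y)) (hAint g hg) (h3.congr h2.symm)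
    rw [integral_congr_ae h2] at h4
    have h5 := h g hg
    have h6 : Integrable fun x => α x * g x + β x * _root_.deriv g x :=
      (memLp_mul_integrable hα (hg.memLp 2)).add (memLp_mul_integrable hβ (hg.deriv.memLp 2))
    have h7 := integral_sub h6 h3
    rw [h4, h5, sub_zero] at h7
    rw [← h7]
    congr 1 with x
    ring
  let b : ContDiffBump (0 : ℝ) := ⟨1, 2, one_pos, one_lt_two⟩
  let φ := b.normed volume
  have hφ : IsTest φ := ⟨b.contDiff_normed, b.hasCompactSupport_normed⟩
  have hφ1 : ∫ x, φ x = 1 := b.integral_normed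
  -- For a test function `ψ` with integral `m`, `ψ - m φ` has mean zero, so it is the derivative of
  -- a test function and is annihilated by `β - A`. Hence `β - A` is the constant `k`.
  let k := ∫ x, (β x - A x) * φ x
  have hk : ∀ᵐ x, β x - A x - k = 0 := by
    refine ae_eq_zero_of_integral_contDiff_smul_eq_zero
      (hl.sub (continuous_const.locallyIntegrable)) fun ψ hψ1 hψ2 => ?_
    have hψ : IsTest ψ := ⟨hψ1, hψ2⟩
    let m := ∫ x, ψ x
    have hψi : Integrable ψ := memLp_one_iff_integrable.1 (hψ.memLp 1)
    have hφi : Integrable φ := memLp_one_iff_integrable.1 (hφ.memLp 1)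
    have hθ : IsTest (fun x => ψ x - m * φ x) :=
      ⟨hψ.1.sub (contDiff_const.mul hφ.1), hψ.2.sub (hφ.2.mul_left (f := fun _ => m))⟩
    obtain ⟨η, hη, hηd⟩ := hθ.exists_deriv_eq (by
      rw [integral_sub hψi (hφi.const_mul m), integral_const_mul, hφ1]; simp [m])
    have h1 := hzero η hη
    rw [hηd] at h1
    have h2 : ∫ x, (β x - A x) * (ψ x - m * φ x) = (∫ x, (β x - A x) * ψ x) - m * k := by
      rw [← integral_const_mul, ← integral_sub (hint ψ hψ) ((hint φ hφ).const_mul m)]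
      congr 1 with x
      ring
    have h3 : ∫ x, ψ x • (β x - A x - k) = (∫ x, (β x - A x) * ψ x) - k * m := by
      rw [← integral_const_mul, ← integral_sub (hint ψ hψ) (hψi.const_mul k)]
      congr 1 with x
      rw [smul_eq_mul]; ring
    rw [h3]
    linarith
  refine ⟨fun x => k + ∫ t in (0 : ℝ)..x, α t, absCont_primitive hαl 0 k, ?_,
    deriv_primitive_ae_eq hαl 0 k⟩
  filter_upwards [hk] with x hx
  simp only [A, zero_add] at hx
  linarith

/-- Integration by parts against test functions extends to `H¹`. -/
lemma integral_eq_zero_of_forall_isTest {α β : ℝ → ℝ} (hα : MemLp α 2 volume)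
    (hβ : MemLp β 2 volume)
    (h : ∀ g, IsTest g → ∫ x, (α x * g x + β x * _root_.deriv g x) = 0) {f : ℝ → ℝ}
    (hf : MemH1 f) : ∫ x, (α x * f x + β x * _root_.deriv f x) = 0 := by
  -- No approximation of `f` is needed: the integrand is the derivative of the integrable function
  -- `B f`.
  obtain ⟨B, hB, hβB, hBd⟩ := exists_primitive_of_weakDeriv hα hβ h
  have h1 : _root_.deriv (B * f) =ᵐ[volume] fun x => α x * f x + β x * _root_.deriv f x := by
    filter_upwards [deriv_mul_ae_eq hB hf.absCont, hβB, hBd] with x h1 h2 h3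
    rw [h1, h2, h3]
  have h2 : Integrable fun x => α x * f x + β x * _root_.deriv f x :=
    (memLp_mul_integrable hα hf.memLp).add (memLp_mul_integrable hβ hf.memLp_deriv)
  rw [← integral_congr_ae h1]
  refine integral_deriv_eq_zero_of_absCont (fun x y => (hB x y).mul (hf.absCont x y)) ?_
    (h2.congr h1.symm)
  exact memLp_mul_integrable (hβ.ae_eq hβB) hf.memLp

end Test

/-! ### The Sobolev space -/

section Sobolev

variable {f g : ℝ → ℝ}

lemma MemH1.continuous (hf : MemH1 f) : Continuous f := continuous_of_absCont hf.absCont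

lemma MemH1.add (hf : MemH1 f) (hg : MemH1 g) :
    MemH1 (f + g) ∧ deriv (f + g) =ᵐ[volume] deriv f + deriv g := by
  have h : deriv (f + g) =ᵐ[volume] deriv f + deriv g := by
    filter_upwards [ae_differentiableAt_of_absCont hf.absCont,
      ae_differentiableAt_of_absCont hg.absCont] with x h1 h2
    exact (h1.hasDerivAt.add h2.hasDerivAt).deriv
  exact ⟨⟨hf.memLp.add hg.memLp, fun x y => (hf.absCont x y).add (hg.absCont x y),
    (hf.memLp_deriv.add hg.memLp_deriv).ae_eq h.symm⟩, h⟩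

lemma MemH1.const_smul (hf : MemH1 f) (r : ℝ) :
    MemH1 (r • f) ∧ deriv (r • f) =ᵐ[volume] r • deriv f := by
  have h : deriv (r • f) =ᵐ[volume] r • deriv f := by
    filter_upwards [ae_differentiableAt_of_absCont hf.absCont] with x h1
    exact (h1.hasDerivAt.const_smul r).deriv
  exact ⟨⟨hf.memLp.const_smul r, fun x y => (hf.absCont x y).const_smul r,
    (hf.memLp_deriv.const_smul r).ae_eq h.symm⟩, h⟩

/-- `f²` has the integrable derivative `2 f f'`. -/
lemma MemH1.exists_bound (hf : MemH1 f) : ∃ M, ∀ x, |f x| ≤ M := by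
  have hd := deriv_mul_ae_eq hf.absCont hf.absCont
  have hi : Integrable (deriv (f * f)) :=
    ((memLp_mul_integrable hf.memLp_deriv hf.memLp).add
      (memLp_mul_integrable hf.memLp hf.memLp_deriv)).congr hd.symm
  refine ⟨√(f 0 * f 0 + ∫ x, ‖deriv (f * f) x‖), fun x => ?_⟩
  refine Real.le_sqrt_of_sq_le ?_
  have h1 := ((hf.absCont 0 x).mul (hf.absCont 0 x)).integral_deriv_eq_sub
  have h2 : ‖∫ y in (0 : ℝ)..x, deriv (f * f) y‖ ≤ ∫ y, ‖deriv (f * f) y‖ := by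
    refine intervalIntegral.norm_integral_le_integral_norm_uIoc.trans ?_
    exact setIntegral_le_integral hi.norm (Eventually.of_forall fun _ => norm_nonneg _)
  rw [h1, Pi.mul_apply, Pi.mul_apply] at h2
  have h3 := le_abs_self (f x * f x - f 0 * f 0)
  rw [Real.norm_eq_abs] at h2
  rw [sq_abs, sq]
  linarith

/-- The graph of the gradient, as a subspace. -/
def gradGraph : Submodule ℝ (L2 × L2) where
  carrier := {p | IsGradient p.1 p.2}
  zero_mem' := ⟨0, ⟨MemLp.zero', fun x y =>
      (LipschitzWith.const (0 : ℝ)).lipschitzOnWith.absolutelyContinuousOnInterval, by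
        have : deriv (0 : ℝ → ℝ) = 0 := funext fun x => by simp
        rw [this]; exact MemLp.zero'⟩, Lp.coeFn_zero _ _ _, by
    have : deriv (0 : ℝ → ℝ) = 0 := funext fun x => by simp
    rw [this]; exact Lp.coeFn_zero _ _ _⟩
  add_mem' := by
    rintro p q ⟨f, hf, hf1, hf2⟩ ⟨g, hg, hg1, hg2⟩
    obtain ⟨h1, h2⟩ := hf.add hg
    exact ⟨f + g, h1, (Lp.coeFn_add _ _).trans (hf1.add hg1),
      ((Lp.coeFn_add _ _).trans (hf2.add hg2)).trans h2.symm⟩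
  smul_mem' := by
    rintro r p ⟨f, hf, hf1, hf2⟩
    obtain ⟨h1, h2⟩ := hf.const_smul r
    exact ⟨r • f, h1, (Lp.coeFn_smul _ _).trans (hf1.const_smul r),
      ((Lp.coeFn_smul _ _).trans (hf2.const_smul r)).trans h2.symm⟩

lemma isGradient_toLp (hf : MemH1 f) : IsGradient (hf.memLp.toLp f) (hf.memLp_deriv.toLp _) :=
  ⟨f, hf, hf.memLp.coeFn_toLp, hf.memLp_deriv.coeFn_toLp⟩

lemma IsGradient.unique {u w w' : L2} (h : IsGradient u w) (h' : IsGradient u w') : w = w' := by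
  obtain ⟨f, hf, hf1, hf2⟩ := h
  obtain ⟨g, hg, hg1, hg2⟩ := h'
  have : f = g := (hf.continuous.ae_eq_iff_eq volume hg.continuous).1 (hf1.symm.trans hg1)
  subst this
  exact Lp.ext (hf2.trans hg2.symm)

lemma dense_gradGraph_domain : Dense {u : L2 | ∃ w, IsGradient u w} := by
  refine (Lp.dense_hasCompactSupport_contDiff (E := ℝ) (F := ℝ) (μ := volume) (p := 2)
    (by norm_num)).mono ?_
  rintro u ⟨g, hug, hg1, hg2⟩
  have hg : IsTest g := ⟨hg2, hg1⟩
  exact ⟨_, g, hg.memH1, hug, hg.memH1.memLp_deriv.coeFn_toLp⟩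

lemma tendsto_setIntegral {ι : Type*} {l : Filter ι} {w : ι → L2} {w₀ : L2}
    (h : Tendsto w l (𝓝 w₀)) {s : Set ℝ} (hs : MeasurableSet s) (hμ : volume s ≠ ∞) :
    Tendsto (fun n => ∫ x in s, w n x) l (𝓝 (∫ x in s, w₀ x)) := by
  simp_rw [← L2.inner_indicatorConstLp_one (𝕜 := ℝ) hs hμ]
  exact tendsto_const_nhds.inner h

lemma tendsto_intervalIntegral {ι : Type*} {l : Filter ι} {w : ι → L2} {w₀ : L2}
    (h : Tendsto w l (𝓝 w₀)) (a b : ℝ) :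
    Tendsto (fun n => ∫ x in a..b, w n x) l (𝓝 (∫ x in a..b, w₀ x)) := by
  simp only [intervalIntegral]
  exact (tendsto_setIntegral h measurableSet_Ioc (by simp)).sub
    (tendsto_setIntegral h measurableSet_Ioc (by simp))

/-- A subsequence of the continuous versions converges a.e. Anchored at one point `x₀` of
convergence, the versions converge everywhere, since the integrals of their gradients over intervals
do; the limit is a primitive of the limit gradient. -/
lemma isClosed_gradGraph : IsClosed (gradGraph : Set (L2 × L2)) := by
  refine IsSeqClosed.isClosed fun p q hp hq => ?_
  choose f hf hf1 hf2 using hp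
  have hq1 : Tendsto (fun n => (p n).1) atTop (𝓝 q.1) := (continuous_fst.tendsto _).comp hq
  have hq2 : Tendsto (fun n => (p n).2) atTop (𝓝 q.2) := (continuous_snd.tendsto _).comp hq
  obtain ⟨ns, hns, hlim⟩ := (tendstoInMeasure_of_tendsto_Lp hq1).exists_seq_tendsto_ae
  have hlim' : ∀ᵐ x, Tendsto (fun i => f (ns i) x) atTop (𝓝 (q.1 x)) := by
    filter_upwards [hlim, ae_all_iff.2 hf1] with x h1 h2
    exact h1.congr fun i => h2 (ns i)
  obtain ⟨x₀, hx₀⟩ := hlim'.exists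
  have hl : LocallyIntegrable q.2 := (Lp.memLp q.2).locallyIntegrable (by norm_num)
  have hconv : ∀ x, Tendsto (fun i => f (ns i) x) atTop
      (𝓝 (q.1 x₀ + ∫ t in x₀..x, q.2 t)) := fun x => by
    refine (hx₀.add (tendsto_intervalIntegral (hq2.comp hns.tendsto_atTop) x₀ x)).congr
      fun i => ?_
    simp only [Function.comp_apply]
    rw [intervalIntegral.integral_congr_ae (g := deriv (f (ns i)))
      ((hf2 (ns i)).mono fun t ht _ => ht), ((hf (ns i)).absCont x₀ x).integral_deriv_eq_sub]
    ring
  have hae : q.1 =ᵐ[volume] fun x => q.1 x₀ + ∫ t in x₀..x, q.2 t := by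
    filter_upwards [hlim'] with x hx
    exact tendsto_nhds_unique hx (hconv x)
  have hder := deriv_primitive_ae_eq hl x₀ (q.1 x₀)
  exact ⟨_, ⟨(Lp.memLp q.1).ae_eq hae, absCont_primitive hl _ _,
    (Lp.memLp q.2).ae_eq hder.symm⟩, hae, hder.symm⟩

end Sobolev

/-! ### Elliptic conductivities, their scale function and their form. -/

/-- Precomposition with a Lipschitz monotone function preserves absolute continuity. -/
lemma absCont_comp {f φ : ℝ → ℝ} {L : ℝ≥0} (hf : ∀ x y, AbsolutelyContinuousOnInterval f x y)
    (hφ : Monotone φ) (hL : LipschitzWith L φ) (x y : ℝ) :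
    AbsolutelyContinuousOnInterval (f ∘ φ) x y := by
  rw [absolutelyContinuousOnInterval_iff]
  intro ε hε
  obtain ⟨δ, hδ, h⟩ := (absolutelyContinuousOnInterval_iff f (φ x) (φ y)).1 (hf _ _) ε hε
  -- `L + 1` instead of `L`, since `L` may be zero.
  have hL1 : (0 : ℝ) < L + 1 := by positivity
  refine ⟨δ / (L + 1), by positivity, fun E hE hEs => ?_⟩
  refine h (E.1, fun i => (φ (E.2 i).1, φ (E.2 i).2)) ⟨fun i hi => ?_, fun i hi j hj hij => ?_⟩ ?_
  · exact ⟨hφ.mapsTo_uIcc (hE.1 i hi).1, hφ.mapsTo_uIcc (hE.1 i hi).2⟩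
  · have := hE.2 hi hj hij
    simp only [Function.onFun, Set.uIoc, Set.Ioc_disjoint_Ioc] at this ⊢
    simpa only [hφ.map_min, hφ.map_max] using hφ this
  · rw [lt_div_iff₀ hL1] at hEs
    refine lt_of_le_of_lt ?_ hEs
    rw [Finset.sum_mul]
    refine Finset.sum_le_sum fun i _ => ?_
    refine (hL.dist_le_mul _ _).trans ?_
    rw [mul_comm]
    gcongr
    linarith

/-- A measurable conductivity, bounded and bounded away from zero. -/
structure IsElliptic (c : ℝ → ℝ) (m M : ℝ) : Prop where
  aemeasurable : AEMeasurable c volume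
  pos : 0 < m
  le : m ≤ M
  bound : ∀ᵐ x, m ≤ c x ∧ c x ≤ M

lemma isElliptic_conductivity {a b : ℝ → ℝ} {δ C ε δ' C' : ℝ}
    (hδ : 0 < δ) (hε : 0 < ε) (hδ' : 0 < δ') (ha_meas : AEMeasurable a volume)
    (ha : ∀ᵐ x ∂(volume : Measure ℝ), δ ≤ a x ∧ a x ≤ C)
    (hb_meas : AEMeasurable b (volume.restrict (Set.Ioo (-ε) ε)))
    (hb : ∀ᵐ x ∂(volume.restrict (Set.Ioo (-ε) ε) : Measure ℝ), δ' ≤ b x ∧ b x ≤ C') :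
    IsElliptic (conductivity a b ε) (min δ δ') (max C C') := by
  have hbound : ∀ᵐ x, min δ δ' ≤ conductivity a b ε x ∧ conductivity a b ε x ≤ max C C' := by
    have h1 := (measurePreserving_sub_right volume ε).quasiMeasurePreserving.ae ha
    have h2 := (measurePreserving_add_right volume ε).quasiMeasurePreserving.ae ha
    filter_upwards [h1, h2, (ae_restrict_iff' measurableSet_Ioo).1 hb] with x h1 h2 h3
    unfold conductivity
    split_ifs with h4 h5
    · exact ⟨(min_le_left _ _).trans h1.1, h1.2.trans (le_max_left _ _)⟩
    · exact ⟨(min_le_left _ _).trans h2.1, h2.2.trans (le_max_left _ _)⟩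
    · have h6 := h3 ⟨not_le.1 h5, not_le.1 h4⟩
      exact ⟨(min_le_right _ _).trans h6.1, h6.2.trans (le_max_right _ _)⟩
  refine ⟨?_, lt_min hδ hδ', ?_, hbound⟩
  · have h1 : AEMeasurable (fun x => a (x - ε)) volume :=
      ha_meas.comp_quasiMeasurePreserving
        (measurePreserving_sub_right volume ε).quasiMeasurePreserving
    have h2 : AEMeasurable (fun x => a (x + ε)) volume :=
      ha_meas.comp_quasiMeasurePreserving
        (measurePreserving_add_right volume ε).quasiMeasurePreserving
    have h3 : AEMeasurable ((Set.Ioo (-ε) ε).indicator b) volume :=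
      (aemeasurable_indicator_iff measurableSet_Ioo).2 hb_meas
    have h4 := ((h1.indicator (measurableSet_Ici (a := ε))).add
      (h2.indicator (measurableSet_Iic (a := -ε)))).add h3
    refine h4.congr (Eventually.of_forall fun x => ?_)
    simp only [Pi.add_apply, Set.indicator, Set.mem_Ici, Set.mem_Iic, Set.mem_Ioo, conductivity]
    split_ifs <;> first | (exfalso; grind) | simp
  · obtain ⟨x, hx⟩ := hbound.exists
    exact hx.1.trans hx.2

namespace IsElliptic

variable {c : ℝ → ℝ} {m M : ℝ}

lemma pos' (hc : IsElliptic c m M) : 0 < M := hc.pos.trans_le hc.le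

lemma inv_bound (hc : IsElliptic c m M) : ∀ᵐ x, M⁻¹ ≤ (c x)⁻¹ ∧ (c x)⁻¹ ≤ m⁻¹ := by
  filter_upwards [hc.bound] with x hx
  exact ⟨inv_anti₀ (hc.pos.trans_le hx.1) hx.2, inv_anti₀ hc.pos hx.1⟩

lemma locallyIntegrable_inv (hc : IsElliptic c m M) : LocallyIntegrable fun x => (c x)⁻¹ := by
  refine (memLp_top_of_bound hc.aemeasurable.inv.aestronglyMeasurable m⁻¹ ?_).locallyIntegrable
    (p := ∞) le_top
  filter_upwards [hc.inv_bound] with x hx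
  rw [Pi.inv_apply, Real.norm_of_nonneg ((inv_nonneg.2 hc.pos'.le).trans hx.1)]
  exact hx.2

lemma scale_sub (hc : IsElliptic c m M) (x y : ℝ) :
    scale c y - scale c x = ∫ t in x..y, (c t)⁻¹ := by
  have h : ∀ a b, IntervalIntegrable (fun t => (c t)⁻¹) volume a b := fun a b =>
    (hc.locallyIntegrable_inv.integrableOn_isCompact isCompact_uIcc).intervalIntegrable
  exact intervalIntegral.integral_interval_sub_left (h _ _) (h _ _)

lemma scale_sub_bound (hc : IsElliptic c m M) {x y : ℝ} (hxy : x ≤ y) :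
    M⁻¹ * (y - x) ≤ scale c y - scale c x ∧ scale c y - scale c x ≤ m⁻¹ * (y - x) := by
  have h : IntervalIntegrable (fun t => (c t)⁻¹) volume x y :=
    (hc.locallyIntegrable_inv.integrableOn_isCompact isCompact_uIcc).intervalIntegrable
  have h1 := intervalIntegral.integral_mono_ae hxy (intervalIntegrable_const (c := M⁻¹)) h
    (hc.inv_bound.mono fun t ht => ht.1)
  have h2 := intervalIntegral.integral_mono_ae hxy h (intervalIntegrable_const (c := m⁻¹))
    (hc.inv_bound.mono fun t ht => ht.2)
  rw [intervalIntegral.integral_const, smul_eq_mul, mul_comm] at h1 h2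
  rw [hc.scale_sub]
  exact ⟨h1, h2⟩

lemma strictMono_scale (hc : IsElliptic c m M) : StrictMono (scale c) := fun x y hxy => by
  have := (hc.scale_sub_bound hxy.le).1
  have h2 : 0 < M⁻¹ * (y - x) := mul_pos (inv_pos.2 hc.pos') (sub_pos.2 hxy)
  linarith

lemma lipschitz_scale (hc : IsElliptic c m M) : LipschitzWith (m⁻¹).toNNReal (scale c) := by
  refine LipschitzWith.of_le_add_mul' _ fun x y => ?_
  rcases le_total x y with h | h
  · have := hc.strictMono_scale.monotone h
    have h2 := mul_nonneg (inv_nonneg.2 hc.pos.le) (dist_nonneg (x := x) (y := y))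
    linarith
  · have := (hc.scale_sub_bound h).2
    rw [Real.dist_eq, abs_of_nonneg (sub_nonneg.2 h)]
    linarith

lemma surjective_scale (hc : IsElliptic c m M) : Function.Surjective (scale c) := by
  have hM := inv_pos.2 hc.pos'
  have h0 : scale c 0 = 0 := by simp [scale]
  refine hc.lipschitz_scale.continuous.surjective ?_ ?_
  · refine tendsto_atTop_mono' _ ?_ (tendsto_id.const_mul_atTop hM)
    filter_upwards [eventually_ge_atTop 0] with x hx
    have := (hc.scale_sub_bound hx).1
    simpa [h0] using this
  · refine tendsto_atBot_mono' _ ?_ (tendsto_id.const_mul_atBot hM)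
    filter_upwards [eventually_le_atBot 0] with x hx
    have := (hc.scale_sub_bound hx).1
    simp only [h0] at this
    simp only [id]
    linarith

/-- The lower bound `1/M` on the slopes of the scale function makes its inverse `M`-Lipschitz. -/
lemma exists_scale_inv (hc : IsElliptic c m M) : ∃ t : ℝ → ℝ, (∀ x, t (scale c x) = x) ∧
    (∀ y, scale c (t y) = y) ∧ Monotone t ∧ LipschitzWith M.toNNReal t := by
  choose t ht using hc.surjective_scale
  have hts : ∀ x, t (scale c x) = x := fun x => hc.strictMono_scale.injective (ht _)
  have hmono : Monotone t := fun x y hxy => by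
    rw [← hc.strictMono_scale.le_iff_le, ht, ht]; exact hxy
  refine ⟨t, hts, ht, hmono, LipschitzWith.of_le_add_mul' _ fun x y => ?_⟩
  rcases le_total x y with h | h
  · have := hmono h
    have h2 := mul_nonneg hc.pos'.le (dist_nonneg (x := x) (y := y))
    linarith
  · have := (hc.scale_sub_bound (hmono h)).1
    rw [ht, ht, inv_mul_le_iff₀ hc.pos'] at this
    rw [Real.dist_eq, abs_of_nonneg (sub_nonneg.2 h)]
    linarith

/-- The chain rule: `df/dλ = c f'`. -/
lemma deriv_comp_scale_ae_eq (hc : IsElliptic c m M) {g : ℝ → ℝ}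
    (hf : ∀ x y, AbsolutelyContinuousOnInterval (g ∘ scale c) x y) :
    deriv g ∘ scale c =ᵐ[volume] fun x => c x * deriv (g ∘ scale c) x := by
  obtain ⟨t, hts, hst, -, htL⟩ := hc.exists_scale_inv
  filter_upwards [ae_differentiableAt_of_absCont hf, hc.bound,
    LocallyIntegrable.ae_hasDerivAt_integral hc.locallyIntegrable_inv] with x h1 h2 h3
  have hcx : c x ≠ 0 := (hc.pos.trans_le h2.1).ne'
  -- Exceptional sets are taken in `x`, not in `s(x)`: differentiability of `s` and `f` at `x` gives
  -- that of `g = f ∘ t` at `s(x)`.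
  have h4 : HasDerivAt t (c x) (scale c x) := by
    have h5 : HasDerivAt (scale c) (c x)⁻¹ (t (scale c x)) := by rw [hts]; exact h3 0
    simpa using h5.of_local_left_inverse htL.continuous.continuousAt (inv_ne_zero hcx)
      (Eventually.of_forall hst)
  have h5 : HasDerivAt (g ∘ scale c) (deriv (g ∘ scale c) x) (t (scale c x)) := by
    rw [hts]; exact h1.hasDerivAt
  have h6 := h5.comp _ h4
  have h7 : (g ∘ scale c) ∘ t = g := funext fun y => by simp [hst]
  rw [h7] at h6
  rw [Function.comp_apply, h6.deriv, mul_comm]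

lemma resistance_le (hc : IsElliptic c m M) :
    resistance c ≤ ENNReal.ofReal m⁻¹ • (volume : Measure ℝ) := by
  rw [← withDensity_const]
  refine withDensity_mono ?_
  filter_upwards [hc.inv_bound] with x hx
  exact ENNReal.ofReal_le_ofReal hx.2

lemma le_resistance (hc : IsElliptic c m M) :
    (volume : Measure ℝ) ≤ ENNReal.ofReal M • resistance c := by
  have h : ENNReal.ofReal M⁻¹ • (volume : Measure ℝ) ≤ resistance c := by
    rw [← withDensity_const]
    refine withDensity_mono ?_
    filter_upwards [hc.inv_bound] with x hx
    exact ENNReal.ofReal_le_ofReal hx.1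
  calc (volume : Measure ℝ) = ENNReal.ofReal M • ENNReal.ofReal M⁻¹ • (volume : Measure ℝ) := by
        rw [smul_smul, ← ENNReal.ofReal_mul hc.pos'.le, mul_inv_cancel₀ hc.pos'.ne',
          ENNReal.ofReal_one, one_smul]
    _ ≤ _ := by gcongr

/-- Makes the conditions at `±∞` in the form domain void. -/
lemma resistance_eq_top (hc : IsElliptic c m M) {s : Set ℝ} (hs : volume s = ∞) :
    resistance c s = ∞ := by
  by_contra h
  have := hc.le_resistance s
  rw [hs, Measure.smul_apply, smul_eq_mul, top_le_iff] at this
  exact ENNReal.mul_ne_top ENNReal.ofReal_ne_top h this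

lemma hasScaleDeriv_comp (hc : IsElliptic c m M) {f t : ℝ → ℝ}
    (hts : ∀ x, t (scale c x) = x) (hmono : Monotone t) (htL : LipschitzWith M.toNNReal t) {u : L2}
    (hf : ∀ x y, AbsolutelyContinuousOnInterval f x y) (hu : u =ᵐ[volume] f) :
    HasScaleDeriv c u (deriv (f ∘ t) ∘ scale c) := by
  have h : (f ∘ t) ∘ scale c = f := funext fun x => by simp [hts]
  refine ⟨f ∘ t, fun x y => absCont_comp hf hmono htL _ _, by rwa [h], rfl, fun hi => ?_,
    fun hi => ?_⟩
  · exact absurd (hc.resistance_eq_top Real.volume_Ici) hi.ne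
  · exact absurd (hc.resistance_eq_top Real.volume_Iic) hi.ne

lemma absCont_of_comp (hc : IsElliptic c m M) {g : ℝ → ℝ}
    (hg : ∀ x y : ℝ, AbsolutelyContinuousOnInterval g (scale c x) (scale c y)) (x y : ℝ) :
    AbsolutelyContinuousOnInterval (g ∘ scale c) x y := by
  obtain ⟨t, -, hst, -, -⟩ := hc.exists_scale_inv
  refine absCont_comp (fun x y => ?_) hc.strictMono_scale.monotone hc.lipschitz_scale x y
  rw [← hst x, ← hst y]
  exact hg _ _

/-- Frees `scaleDeriv` from the choice in its definition: continuous versions agreeing a.e. agree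
everywhere, and the scale function is onto. -/
lemma hasScaleDeriv_unique (hc : IsElliptic c m M) {u : L2} {h h' : ℝ → ℝ}
    (H : HasScaleDeriv c u h) (H' : HasScaleDeriv c u h') : h = h' := by
  obtain ⟨g, hg, hug, rfl, -⟩ := H
  obtain ⟨g', hg', hug', rfl, -⟩ := H'
  have h1 : g ∘ scale c = g' ∘ scale c :=
    ((continuous_of_absCont (hc.absCont_of_comp hg)).ae_eq_iff_eq volume
      (continuous_of_absCont (hc.absCont_of_comp hg'))).1 (hug.symm.trans hug')
  rw [hc.surjective_scale.injective_comp_right h1]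

lemma scaleDeriv_eq (hc : IsElliptic c m M) {u : L2} {h : ℝ → ℝ} (H : HasScaleDeriv c u h) :
    scaleDeriv c u = h := by
  have hex : ∃ w, HasScaleDeriv c u w := ⟨h, H⟩
  rw [scaleDeriv, dif_pos hex]
  exact hc.hasScaleDeriv_unique hex.choose_spec H

lemma scaleDeriv_ae_eq (hc : IsElliptic c m M) {u w : L2} (hu : IsGradient u w) :
    scaleDeriv c u =ᵐ[volume] fun x => c x * w x := by
  obtain ⟨f, hf, huf, hwf⟩ := hu
  obtain ⟨t, hts, hst, hmono, htL⟩ := hc.exists_scale_inv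
  rw [hc.scaleDeriv_eq (hc.hasScaleDeriv_comp hts hmono htL hf.absCont huf)]
  have h : (f ∘ t) ∘ scale c = f := funext fun x => by simp [hts]
  have h1 := hc.deriv_comp_scale_ae_eq (g := f ∘ t) (by rw [h]; exact hf.absCont)
  rw [h] at h1
  filter_upwards [h1, hwf] with x h1 h2
  rw [h1, h2]

/-- The form domain is `H¹(ℝ)`. -/
lemma mem_formDomain_iff (hc : IsElliptic c m M) {u : L2} :
    u ∈ formDomain c ↔ ∃ w, IsGradient u w := by
  obtain ⟨t, hts, hst, hmono, htL⟩ := hc.exists_scale_inv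
  constructor
  · rintro ⟨h, ⟨g, hg, hug, rfl, -⟩, hh⟩
    have hf := hc.absCont_of_comp hg
    have h1 := hc.deriv_comp_scale_ae_eq hf
    have h2 : MemLp (deriv g ∘ scale c) 2 volume :=
      hh.of_measure_le_smul ENNReal.ofReal_ne_top hc.le_resistance
    have h3 : MemLp (deriv (g ∘ scale c)) 2 volume := by
      refine h2.of_le_mul (c := m⁻¹) (measurable_deriv _).aestronglyMeasurable ?_
      filter_upwards [h1, hc.bound] with x h1 h2
      rw [h1, norm_mul, Real.norm_of_nonneg (hc.pos.le.trans h2.1), ← mul_assoc]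
      refine le_mul_of_one_le_left (norm_nonneg _) ?_
      rw [inv_mul_eq_div, one_le_div hc.pos]
      exact h2.1
    exact ⟨_, _, ⟨(Lp.memLp u).ae_eq hug, hf, h3⟩, hug, h3.coeFn_toLp⟩
  · rintro ⟨w, hu⟩
    have h1 := hc.scaleDeriv_ae_eq hu
    obtain ⟨f, hf, huf, hwf⟩ := hu
    have H := hc.hasScaleDeriv_comp hts hmono htL hf.absCont huf
    refine ⟨_, H, ?_⟩
    rw [← hc.scaleDeriv_eq H]
    have h2 : MemLp (fun x => c x * w x) 2 volume := by
      refine (Lp.memLp w).of_le_mul (c := M)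
        (hc.aemeasurable.aestronglyMeasurable.mul (Lp.aestronglyMeasurable w)) ?_
      filter_upwards [hc.bound] with x h2
      rw [norm_mul, Real.norm_of_nonneg (hc.pos.le.trans h2.1)]
      exact mul_le_mul_of_nonneg_right h2.2 (norm_nonneg _)
    exact (h2.ae_eq h1.symm).of_measure_le_smul ENNReal.ofReal_ne_top hc.resistance_le

/-- Two factors `c` from the chain rule, against the density `1/c` of the resistance. -/
lemma energy_eq (hc : IsElliptic c m M) {u w v z : L2} (hu : IsGradient u w)
    (hv : IsGradient v z) : energy c u v = 1 / 2 * ∫ x, c x * w x * z x := by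
  rw [energy, resistance]
  change 1 / 2 * ∫ x, _ ∂(volume.withDensity fun x => ((c x)⁻¹.toNNReal : ℝ≥0∞)) = _
  have hm : AEMeasurable (fun x => (c x)⁻¹.toNNReal) volume := hc.aemeasurable.inv.real_toNNReal
  rw [integral_withDensity_eq_integral_smul₀ hm]
  congr 1
  refine integral_congr_ae ?_
  filter_upwards [hc.scaleDeriv_ae_eq hu, hc.scaleDeriv_ae_eq hv, hc.bound] with x h1 h2 h3
  have hcx := hc.pos.trans_le h3.1
  rw [h1, h2, NNReal.smul_def, Real.coe_toNNReal _ (inv_nonneg.2 hcx.le), smul_eq_mul]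
  field_simp

end IsElliptic

/-! ### The weighted energy as a norm -/

lemma exists_mul_clm {κ : ℝ → ℝ} (hκ : AEMeasurable κ volume) {B : ℝ} (hB : ∀ᵐ x, |κ x| ≤ B) :
    ∃ T : L2 →L[ℝ] L2, ∀ w, T w =ᵐ[volume] fun x => κ x * w x := by
  have hle : ∀ w : L2, ∀ᵐ x, ‖κ x * w x‖ ≤ B * ‖w x‖ := fun w => by
    filter_upwards [hB] with x hx
    rw [norm_mul]
    exact mul_le_mul_of_nonneg_right hx (norm_nonneg _)
  have hmem : ∀ w : L2, MemLp (fun x => κ x * w x) 2 volume := fun w =>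
    (Lp.memLp w).of_le_mul (hκ.aestronglyMeasurable.mul (Lp.aestronglyMeasurable w)) (hle w)
  refine ⟨LinearMap.mkContinuous
    { toFun := fun w => (hmem w).toLp _
      map_add' := fun w z => ?_
      map_smul' := fun r w => ?_ } B fun w => ?_, fun w => (hmem w).coeFn_toLp⟩
  · refine Lp.ext ?_
    filter_upwards [(hmem (w + z)).coeFn_toLp, (hmem w).coeFn_toLp, (hmem z).coeFn_toLp,
      Lp.coeFn_add w z, Lp.coeFn_add ((hmem w).toLp _) ((hmem z).toLp _)] with x h1 h2 h3 h4 h5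
    rw [h1, h5, Pi.add_apply, h2, h3, h4, Pi.add_apply, mul_add]
  · refine Lp.ext ?_
    filter_upwards [(hmem (r • w)).coeFn_toLp, (hmem w).coeFn_toLp,
      Lp.coeFn_smul r w, Lp.coeFn_smul r ((hmem w).toLp _)] with x h1 h2 h3 h4
    rw [RingHom.id_apply, h1, h4, Pi.smul_apply, h2, h3, Pi.smul_apply, smul_eq_mul, smul_eq_mul]
    ring
  · refine Lp.norm_le_mul_norm_of_ae_le_mul ?_
    filter_upwards [(hmem w).coeFn_toLp, hle w] with x h1 h2
    simp only [LinearMap.coe_mk, AddHom.coe_mk]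
    rw [h1]
    exact h2

/-- `T` and `S` are multiplication by `√(c/2)` and its inverse. -/
lemma IsElliptic.exists_sqrt_clm {c : ℝ → ℝ} {m M : ℝ} (hc : IsElliptic c m M) :
    ∃ T S : L2 →L[ℝ] L2, (∀ w, T (S w) = w) ∧ (∀ w, S (T w) = w) ∧
      ∀ w z, inner ℝ (T w) (T z) = 1 / 2 * ∫ x, c x * w x * z x := by
  have hm : AEMeasurable (fun x => √(c x / 2)) volume := (hc.aemeasurable.div_const 2).sqrt
  obtain ⟨T, hT⟩ := exists_mul_clm hm (B := √(M / 2)) (by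
    filter_upwards [hc.bound] with x hx
    rw [abs_of_nonneg (Real.sqrt_nonneg _)]
    exact Real.sqrt_le_sqrt (by linarith))
  obtain ⟨S, hS⟩ := exists_mul_clm hm.inv (B := (√(m / 2))⁻¹) (by
    filter_upwards [hc.bound] with x hx
    rw [Pi.inv_apply, abs_of_nonneg (inv_nonneg.2 (Real.sqrt_nonneg _))]
    have := hc.pos
    exact inv_anti₀ (Real.sqrt_pos.2 (by linarith)) (Real.sqrt_le_sqrt (by linarith)))
  have hne : ∀ᵐ x, √(c x / 2) ≠ 0 := by
    filter_upwards [hc.bound] with x hx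
    have := hc.pos
    exact (Real.sqrt_pos.2 (by linarith)).ne'
  refine ⟨T, S, fun w => Lp.ext ?_, fun w => Lp.ext ?_, fun w z => ?_⟩
  · filter_upwards [hT (S w), hS w, hne] with x h1 h2 h3
    rw [h1, h2, Pi.inv_apply, mul_inv_cancel_left₀ h3]
  · filter_upwards [hS (T w), hT w, hne] with x h1 h2 h3
    rw [h1, h2, Pi.inv_apply, inv_mul_cancel_left₀ h3]
  · rw [L2.inner_def, ← integral_const_mul]
    refine integral_congr_ae ?_
    filter_upwards [hT w, hT z, hc.bound] with x h1 h2 h3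
    have h4 : √(c x / 2) * √(c x / 2) = c x / 2 :=
      Real.mul_self_sqrt (by linarith [hc.pos])
    rw [h1, h2, real_inner_eq_re_inner, RCLike.inner_apply]
    simp only [conj_trivial, RCLike.re_to_real]
    linear_combination (w x * z x) * h4

/-- The graph of the gradient, with the second component transformed by `S⁻¹`. -/
noncomputable def energyGraph (S : L2 →L[ℝ] L2) : Submodule ℝ (L2 × L2) :=
  gradGraph.comap ((ContinuousLinearMap.id ℝ L2).prodMap S : L2 × L2 →L[ℝ] L2 × L2).toLinearMap

lemma mem_energyGraph {S : L2 →L[ℝ] L2} {p : L2 × L2} :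
    p ∈ energyGraph S ↔ IsGradient p.1 (S p.2) := Iff.rfl

lemma isClosed_energyGraph (S : L2 →L[ℝ] L2) : IsClosed (energyGraph S : Set (L2 × L2)) :=
  isClosed_gradGraph.preimage ((ContinuousLinearMap.id ℝ L2).prodMap S).continuous

/-! ### The semigroup of the conductivity and its weak solutions. -/

section Main

variable {c : ℝ → ℝ} {m M : ℝ} {T S : L2 →L[ℝ] L2} {P : ℝ≥0 → L2 →L[ℝ] L2}

lemma generator_iff (hc : IsElliptic c m M) (hTS : ∀ w, T (S w) = w) (hST : ∀ w, S (T w) = w)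
    (hT : ∀ w z, inner ℝ (T w) (T z) = 1 / 2 * ∫ x, c x * w x * z x) (u f : L2) :
    FormGenerator (energyGraph S) u f ↔
      u ∈ formDomain c ∧ ∀ v ∈ formDomain c, energy c u v = -inner ℝ f v := by
  constructor
  · rintro ⟨w, hw, hwf⟩
    rw [mem_energyGraph] at hw
    refine ⟨hc.mem_formDomain_iff.2 ⟨_, hw⟩, fun v hv => ?_⟩
    obtain ⟨z, hz⟩ := hc.mem_formDomain_iff.1 hv
    have := hwf (v, T z) (by rw [mem_energyGraph, hST]; exact hz)
    rw [hc.energy_eq hw hz, ← hT, hTS, this]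
  · rintro ⟨hu, huf⟩
    obtain ⟨w, hw⟩ := hc.mem_formDomain_iff.1 hu
    refine ⟨T w, by rw [mem_energyGraph, hST]; exact hw, fun p hp => ?_⟩
    rw [mem_energyGraph] at hp
    rw [← huf _ (hc.mem_formDomain_iff.2 ⟨_, hp⟩), hc.energy_eq hw hp, ← hT, hTS]

lemma isSemigroupOf_iff (hc : IsElliptic c m M) (hTS : ∀ w, T (S w) = w)
    (hST : ∀ w, S (T w) = w)
    (hT : ∀ w z, inner ℝ (T w) (T z) = 1 / 2 * ∫ x, c x * w x * z x) :
    IsSemigroupOf (formDomain c) (energy c) P ↔ IsSymmSemigroup (FormGenerator (energyGraph S)) P :=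
  ⟨fun h => ⟨h.zero, h.add, h.contraction, h.symm, h.continuous, fun u f =>
      (h.generator u f).trans (generator_iff hc hTS hST hT u f).symm⟩,
    fun h => ⟨h.zero, h.add, h.contraction, h.symm, h.continuous, fun u f =>
      (h.generator u f).trans (generator_iff hc hTS hST hT u f)⟩⟩

lemma isNonposSelfAdjoint_energyGraph (hST : ∀ w, S (T w) = w) :
    IsNonposSelfAdjoint (FormGenerator (energyGraph S)) := by
  refine isNonposSelfAdjoint_formGenerator (isClosed_energyGraph S) ?_
  refine dense_gradGraph_domain.mono ?_
  rintro u ⟨w, hw⟩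
  exact ⟨T w, by rw [mem_energyGraph, hST]; exact hw⟩

lemma energyGraph_eq_zero (hTS : ∀ w, T (S w) = w) {w : L2} (hw : ((0 : L2), w) ∈ energyGraph S) :
    w = 0 := by
  rw [mem_energyGraph] at hw
  have h0 : IsGradient 0 0 := gradGraph.zero_mem
  rw [← hTS w, hw.unique h0, map_zero]

lemma inner_toLp_eq {g : ℝ → ℝ} (hg : MemLp g 2 volume) (u : L2) :
    inner ℝ u (hg.toLp g) = ∫ x, u x * g x := by
  rw [L2.inner_def]
  refine integral_congr_ae ?_
  filter_upwards [hg.coeFn_toLp] with x hx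
  rw [hx, real_inner_eq_re_inner, RCLike.inner_apply]
  simp [mul_comm]

lemma inner_toLp_sub_eq {u₀ g : ℝ → ℝ} (hu₀ : MemLp u₀ 2 volume) (hg : MemLp g 2 volume) (u : L2) :
    inner ℝ (hu₀.toLp u₀ - u) (hg.toLp g) = ∫ x, (u₀ x - u x) * g x := by
  rw [inner_toLp_eq]
  refine integral_congr_ae ?_
  filter_upwards [hu₀.coeFn_toLp, Lp.coeFn_sub (hu₀.toLp u₀) u] with x h1 h2
  rw [h2, Pi.sub_apply, h1]

lemma inner_clm_toLp_eq (hT : ∀ w z, inner ℝ (T w) (T z) = 1 / 2 * ∫ x, c x * w x * z x)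
    {g : ℝ → ℝ} (hg : MemLp g 2 volume) (w : L2) :
    inner ℝ (T w) (T (hg.toLp g)) = 1 / 2 * ∫ x, c x * w x * g x := by
  rw [hT]
  congr 1
  refine integral_congr_ae ?_
  filter_upwards [hg.coeFn_toLp] with x h1
  rw [h1]

/-- The evolution `W` of the weighted gradient is continuous and bounded, so `S (W s)` serves as the
gradient; the weak equation is the form evolution tested with `(g, T g')`. -/
theorem isWeakSolution_semigroup (hTS : ∀ w, T (S w) = w)
    (hST : ∀ w, S (T w) = w)
    (hT : ∀ w z, inner ℝ (T w) (T z) = 1 / 2 * ∫ x, c x * w x * z x)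
    (hP : IsSymmSemigroup (FormGenerator (energyGraph S)) P) {u₀ : ℝ → ℝ} (hu₀ : MemH1 u₀) :
    IsWeakSolution c u₀ (fun t => P t (hu₀.memLp.toLp u₀)) := by
  have hmem : (hu₀.memLp.toLp u₀, T (hu₀.memLp_deriv.toLp _)) ∈ energyGraph S := by
    rw [mem_energyGraph, hST]; exact isGradient_toLp hu₀
  obtain ⟨W, hWc, hWK, hWle, hW⟩ := exists_form_evolution (isClosed_energyGraph S)
    (fun w => energyGraph_eq_zero hTS) hP hmem
  have hc1 : Continuous fun t : ℝ => S (W t.toNNReal) :=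
    S.continuous.comp (hWc.comp continuous_real_toNNReal)
  refine ⟨hP.continuous _, ⟨_, fun t => hP.norm_apply_le t _⟩, ?_,
    fun s => S (W s.toNNReal), ⟨?_, ?_, ?_⟩, fun t ht g hg1 hg2 => ?_⟩
  · simp only [hP.zero, ContinuousLinearMap.id_apply]
    exact hu₀.memLp.coeFn_toLp
  · exact memLp_top_of_bound (hP.continuous_toNNReal _).aestronglyMeasurable _
      (Eventually.of_forall fun t => hP.norm_apply_le _ _)
  · exact memLp_top_of_bound hc1.aestronglyMeasurable (‖S‖ * ‖T (hu₀.memLp_deriv.toLp _)‖)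
      (Eventually.of_forall fun t => S.le_opNorm_of_le (hWle _))
  · exact Eventually.of_forall fun t => hWK _
  · have hg : MemH1 g := IsTest.memH1 ⟨hg1, hg2⟩
    have h1 := hW (hg.memLp.toLp g, T (hg.memLp_deriv.toLp _)) (by
      rw [mem_energyGraph, hST]; exact isGradient_toLp hg) t
    rw [← inner_toLp_sub_eq hu₀.memLp hg.memLp, ← neg_sub, inner_neg_left, h1, neg_neg,
      ← intervalIntegral.integral_const_mul]
    congr 1 with s
    rw [← inner_clm_toLp_eq hT hg.memLp_deriv, hTS]

/-- The weak formulation extends to test functions in `H¹`. -/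
lemma IsWeakSolution.inner_sub_eq (hc : IsElliptic c m M) (hTS : ∀ w, T (S w) = w)
    (hST : ∀ w, S (T w) = w)
    (hT : ∀ w z, inner ℝ (T w) (T z) = 1 / 2 * ∫ x, c x * w x * z x)
    {u₀ : ℝ → ℝ} (hu₀ : MemLp u₀ 2 volume) {v : ℝ≥0 → L2} (hv : IsWeakSolution c u₀ v)
    {y g : L2} (hy : FormGenerator (energyGraph S) y g) (t : ℝ≥0) :
    inner ℝ (v t - hu₀.toLp u₀) y = ∫ s in (0 : ℝ)..t, inner ℝ (v s.toNNReal) g := by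
  rcases eq_or_ne t 0 with rfl | ht
  · have : v 0 = hu₀.toLp u₀ := Lp.ext (hv.initial.trans hu₀.coeFn_toLp.symm)
    simp [this]
  obtain ⟨w, ⟨-, hw, hgrad⟩, hweak⟩ := hv.weak
  have hsub : volume.restrict (Set.Ioc (0 : ℝ) t) ≤ volume.restrict (Set.Ici 0) :=
    Measure.restrict_mono (fun x hx => hx.1.le) le_rfl
  have hint : IntervalIntegrable (fun s => T (w s)) volume 0 t := by
    rw [intervalIntegrable_iff_integrableOn_Ioc_of_le t.coe_nonneg]
    have h1 : MemLp w ∞ (volume.restrict (Set.Ioc (0 : ℝ) t)) := hw.mono_measure hsub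
    exact T.integrable_comp (h1.integrable le_top)
  -- Integrating over time inside `L²` turns the equation at fixed `t` into a stationary one, with
  -- `α = u₀ - v t` and `β = -½ c S ω`.
  let ω : L2 := ∫ s in (0 : ℝ)..t, T (w s)
  have hω : ∀ z, inner ℝ ω z = ∫ s in (0 : ℝ)..t, inner ℝ (T (w s)) z := fun z => by
    have := (innerSL ℝ z).intervalIntegral_comp_comm hint
    simp only [innerSL_apply_apply] at this
    rw [real_inner_comm, ← this]
    simp_rw [real_inner_comm z]
  have hcS : MemLp (fun x => -(1 / 2 * (c x * (S ω) x))) 2 volume := by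
    refine (MemLp.const_mul ?_ (1 / 2)).neg
    refine (Lp.memLp (S ω)).of_le_mul (c := M)
      (hc.aemeasurable.aestronglyMeasurable.mul (Lp.aestronglyMeasurable _)) ?_
    filter_upwards [hc.bound] with x h2
    rw [norm_mul, Real.norm_of_nonneg (hc.pos.le.trans h2.1)]
    exact mul_le_mul_of_nonneg_right h2.2 (norm_nonneg _)
  have hα : MemLp (fun x => u₀ x - v t x) 2 volume := hu₀.sub (Lp.memLp (v t))
  have hsplit : ∀ {φ : ℝ → ℝ}, MemH1 φ →
      ∫ x, ((u₀ x - v t x) * φ x + -(1 / 2 * (c x * (S ω) x)) * deriv φ x) =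
        (∫ x, (u₀ x - v t x) * φ x) - 1 / 2 * ∫ x, c x * (S ω) x * deriv φ x := fun {φ} hφ => by
    rw [integral_add (memLp_mul_integrable hα hφ.memLp)
      (memLp_mul_integrable hcS hφ.memLp_deriv), sub_eq_add_neg, ← integral_const_mul,
      ← integral_neg]
    congr 2 with x
    ring
  obtain ⟨ζ, hζ, hζg⟩ := hy
  -- As `y` is in the domain of the generator, the form moves back onto `v s`, and no gradient of
  -- `v` remains.
  have hgrad' : ∀ᵐ s ∂(volume.restrict (Set.Ioc (0 : ℝ) t)),
      inner ℝ (T (w s)) ζ = -inner ℝ (v s.toNNReal) g := by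
    filter_upwards [ae_mono hsub hgrad] with s hs
    have := hζg (v s.toNNReal, T (w s)) (by rw [mem_energyGraph, hST]; exact hs)
    rw [real_inner_comm, this, real_inner_comm]
  rw [mem_energyGraph] at hζ
  obtain ⟨f, hf, hyf, hζf⟩ := hζ
  have key := integral_eq_zero_of_forall_isTest hα hcS (fun φ hφ => by
    rw [hsplit hφ.memH1, hweak t (pos_iff_ne_zero.2 ht) φ hφ.1 hφ.2,
      ← inner_clm_toLp_eq hT hφ.memH1.memLp_deriv, hTS, hω,
      ← intervalIntegral.integral_const_mul, sub_eq_zero]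
    congr 1 with s
    rw [inner_clm_toLp_eq hT hφ.memH1.memLp_deriv]) hf
  rw [hsplit hf, ← inner_clm_toLp_eq hT hf.memLp_deriv, ← inner_toLp_sub_eq hu₀ hf.memLp] at key
  have e1 : hf.memLp.toLp f = y := Lp.ext (hf.memLp.coeFn_toLp.trans hyf.symm)
  have e2 : hf.memLp_deriv.toLp _ = S ζ := Lp.ext (hf.memLp_deriv.coeFn_toLp.trans hζf.symm)
  rw [e1, e2, hTS, hTS, hω, ← neg_sub (v t), inner_neg_left] at key
  have h3 : ∫ s in (0 : ℝ)..t, inner ℝ (T (w s)) ζ =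
      -∫ s in (0 : ℝ)..t, inner ℝ (v s.toNNReal) g := by
    rw [← intervalIntegral.integral_neg, intervalIntegral.integral_of_le t.coe_nonneg,
      intervalIntegral.integral_of_le t.coe_nonneg]
    exact integral_congr_ae hgrad'
  linarith

/-- `v t - P t u₀` solves the integrated equation with zero initial value. -/
theorem IsWeakSolution.eq_semigroup (hc : IsElliptic c m M) (hTS : ∀ w, T (S w) = w)
    (hST : ∀ w, S (T w) = w)
    (hT : ∀ w z, inner ℝ (T w) (T z) = 1 / 2 * ∫ x, c x * w x * z x)
    (hP : IsSymmSemigroup (FormGenerator (energyGraph S)) P)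
    {u₀ : ℝ → ℝ} (hu₀ : MemLp u₀ 2 volume) {v : ℝ≥0 → L2} (hv : IsWeakSolution c u₀ v) :
    v = fun t => P t (hu₀.toLp u₀) := by
  funext t
  let U := hu₀.toLp u₀
  refine sub_eq_zero.1 ((isNonposSelfAdjoint_energyGraph hST).eq_zero_of_forall_inner
    (z := fun t => v t - P t U) (hv.continuous.sub (hP.continuous U)) (fun t y g hy => ?_) t)
  have e : v t - P t U = (v t - U) - (P t U - U) := by abel
  change inner ℝ (v t - P t U) y = ∫ s in (0 : ℝ)..t, inner ℝ (v s.toNNReal - P s.toNNReal U) g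
  rw [e, inner_sub_left (v t - U), hP.inner_apply_sub t U hy,
    hv.inner_sub_eq hc hTS hST hT hu₀ hy t]
  rw [← intervalIntegral.integral_sub]
  · simp only [inner_sub_left]
  · exact ((hv.continuous.comp continuous_real_toNNReal).inner
      continuous_const).intervalIntegrable _ _
  · exact ((hP.continuous_toNNReal U).inner continuous_const).intervalIntegrable _ _

end Main

end StiffHeat

/-! ### The theorem. -/

theorem lemma4p12
    (a b : ℝ → ℝ) (δ C ε δ' C' : ℝ)
    (hδ : 0 < δ) (hC : 0 < C) (hε : 0 < ε) (hδ' : 0 < δ') (hC' : 0 < C')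
    (ha_meas : AEMeasurable a volume)
    (ha : ∀ᵐ x ∂(volume : Measure ℝ), δ ≤ a x ∧ a x ≤ C)
    (hb_meas : AEMeasurable b (volume.restrict (Set.Ioo (-ε) ε)))
    (hb : ∀ᵐ x ∂(volume.restrict (Set.Ioo (-ε) ε) : Measure ℝ), δ' ≤ b x ∧ b x ≤ C') :
    -- the semigroup of the Dirichlet form is well defined
    (∃! P : ℝ≥0 → StiffHeat.L2 →L[ℝ] StiffHeat.L2,
      StiffHeat.IsSemigroupOf (StiffHeat.formDomain (StiffHeat.conductivity a b ε))
        (StiffHeat.energy (StiffHeat.conductivity a b ε)) P) ∧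
    ∀ P : ℝ≥0 → StiffHeat.L2 →L[ℝ] StiffHeat.L2,
      StiffHeat.IsSemigroupOf (StiffHeat.formDomain (StiffHeat.conductivity a b ε))
        (StiffHeat.energy (StiffHeat.conductivity a b ε)) P →
      ∀ (u₀ : ℝ → ℝ) (hu₀ : StiffHeat.MemH1 u₀),
        -- `P_t u₀` is a weak solution
        StiffHeat.IsWeakSolution (StiffHeat.conductivity a b ε) u₀
          (fun t => P t (hu₀.memLp.toLp u₀)) ∧
        -- it is the only one
        (∀ v : ℝ≥0 → StiffHeat.L2,
          StiffHeat.IsWeakSolution (StiffHeat.conductivity a b ε) u₀ v →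
            v = fun t => P t (hu₀.memLp.toLp u₀)) ∧
        -- `P_t u₀(x) = 𝐄_x u₀(X_t)` for the associated diffusion `X`
        (∀ (Ω : Type*) [MeasurableSpace Ω] (Y : StiffHeat.ContMarkovProcess Ω),
          Y.HasSemigroup P → ∀ t : ℝ≥0,
            P t (hu₀.memLp.toLp u₀) =ᵐ[volume] fun x => ∫ ω, u₀ (Y.X t ω) ∂(Y.law x)) := by
  have hc := StiffHeat.isElliptic_conductivity hδ hε hδ' ha_meas ha hb_meas hb
  obtain ⟨T, S, hTS, hST, hT⟩ := hc.exists_sqrt_clm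
  have hG := StiffHeat.isNonposSelfAdjoint_energyGraph hST
  have hiff := fun P => StiffHeat.isSemigroupOf_iff (P := P) hc hTS hST hT
  refine ⟨?_, fun P hP u₀ hu₀ => ⟨?_, fun v hv => ?_, fun Ω _ Y hY t => ?_⟩⟩
  · obtain ⟨P, hP⟩ := hG.exists_semigroup
    exact ⟨P, (hiff P).2 hP, fun Q hQ => hG.semigroup_unique ((hiff Q).1 hQ) hP⟩
  · exact StiffHeat.isWeakSolution_semigroup hTS hST hT ((hiff P).1 hP) hu₀
  · exact hv.eq_semigroup hc hTS hST hT ((hiff P).1 hP) hu₀.memLp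
  · exact hY t u₀ hu₀.memLp hu₀.continuous.measurable hu₀.exists_bound
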